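/- **Notation.** All functions and distributions are real-valued; $\mathcal D$ is the space of test functions on $\mathbb R$, $\mathcal D'$ the space of Schwartz distributions on $\mathbb R$, $D_x$ the distributional derivative, and locally integrable functions are identified with regular distributions. $\mathcal C$ is the space of continuous functions and $\mathcal C^\infty_p$ the space of piecewise smooth functions: $f\in\mathcal C^\infty_p$ iff there is a finite $I\subset\mathbb R$ with $f\in\mathcal C^\infty(\mathbb R\setminus I)$ such that $\lim_{x\to x_0^{\pm}}f^{(n)}(x)$ exist and are finite for all $x_0\in I$, $n\ge 0$. Put $\mathcal A=\bigcup_{i\ge 0}D_x^i[\mathcal C_p^\infty]$. Each $F\in\mathcal A$ is uniquely $F=f+\sum_{x\in I_F}\Delta^F_x$ with $f\in\mathcal C^\infty_p$ (up to null sets), $I_F$ finite, and $\Delta^F_x\neq 0$ a finite real linear combination of the $\delta_x^{(j)}$, $j\ge 0$. If $F,G\in\mathcal D'$ have finite disjoint singular supports, their Hörmander product $F\cdot G\in\mathcal D'$ is determined by $(F\cdot G)|_{\Omega_i}=F|_{\Omega_i}G|_{\Omega_i}$ for a finite open covering $(\Omega_i)$ of $\mathbb R$ on each member of which $F$ or $G$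 is a smooth function, where the right-hand side is the product of a smooth function by a distribution, $\langle\phi F,t\rangle=\langle F,\phi t\rangle$. For $F,G\in\mathcal A$ let $F*G=\lim_{\varepsilon\downarrow0}F(x)\cdot G(x+\varepsilon)$ in the sense of distributions. For $M\subseteq\mathbb R$ and $F=f+\sum_{x\in I_F}\Delta^F_x$, $G=g+\sum_{y\in I_G}\Delta^G_y$ in $\mathcal A$ let $$F*_MG=fg+\sum_{y\in I_G\cap M}f*\Delta^G_y+\sum_{x\in I_F\cap M}\Delta^F_x*g+\sum_{y\in I_G\setminus M}\Delta^G_y*f+\sum_{x\in I_F\setminus M}g*\Delta^F_x .$$ **Theorem.** Let $\mathcal G$ be a linear subspace of $\mathcal D'$ and $\circledast:\mathcal G\times\mathcal G\to\mathcal G$ a bilinear associative product such that: * $\mathcal C_p^\infty\subseteq\mathcal G$; * the constant function $1$ is the identity for $\circledast$; * there is a linear operator $D:\mathcal G\to\mathcal G$ which satisfies the Leibniz rule for $\circledast$ and coincides with $D_x$ on $\mathcal G$; * $F\circledast G$ is the pointwise product of $F$ and $G$ for all $F,G\in\mathcal G\cap\mathcal C$; * every $F\in\mathcal G$ is locally a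 finite order derivative of a continuous element of $\mathcal G$: for each $x\in\mathbb R$ there are an open $\Omega\ni x$, $k\ge0$ and $g\in\mathcal G\cap\mathcal C$ with $F|_\Omega=(D_x^kg)|_\Omega$; * $\circledast$ is partially continuous at zero: for every $\xi\in\mathcal C^\infty(\mathbb R)$ and every sequence $(F_n)$ in $\mathcal G$ with $F_n\to0$ in the sense of distributions, $\xi\circledast F_n\to0$ and $F_n\circledast\xi\to0$ in the sense of distributions. Then $\mathcal A\subseteq\mathcal G$, and there is $M\subseteq\mathbb R$ such that $F\circledast G=F*_MG$ for all $F,G\in\mathcal A$ (the product $F*_MG$ being well defined). In other words, $(\mathcal A,+,*_M)$ is a subalgebra of $(\mathcal G,+,\circledast)$: $\mathcal A$ is a linear subspace, closed under $\circledast$. -/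

import Mathlib

open Set Filter Topology MeasureTheory TopologicalSpace
open scoped Distributions ContDiff

namespace DistrAlg

noncomputable section

/-- Real test functions on the open set `Ω ⊆ ℝ`. -/
abbrev TestFn (Ω : Opens ℝ) : Type := TestFunction Ω ℝ ⊤

/-- Real distributions on the open set `Ω ⊆ ℝ`. -/
abbrev DistrOn (Ω : Opens ℝ) : Type := Distribution Ω ℝ ⊤

/-- The space `𝓓'` of real Schwartz distributions over `ℝ`. -/
abbrev Distr : Type := DistrOn ⊤

/-- The regular distribution `t ↦ ∫ f t` on `Ω` attached to a function `f` which is locally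
integrable on `Ω` (it is `0` for other functions). -/
def regOn (Ω : Opens ℝ) (f : ℝ → ℝ) : DistrOn Ω :=
  (TestFunction.integralAgainstBilinCLM (ContinuousLinearMap.mul ℝ ℝ) volume f :
    TestFn Ω →L[ℝ] ℝ)

theorem regOn_apply (Ω : Opens ℝ) {f : ℝ → ℝ} (hf : LocallyIntegrableOn f Ω) (t : TestFn Ω) :
    regOn Ω f t = ∫ x, t x * f x :=
  TestFunction.integralAgainstBilinCLM_eq_integral hf

/-- The regular distribution on `ℝ` attached to a locally integrable function. -/
def reg (f : ℝ → ℝ) : Distr := regOn ⊤ f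

/-- The restriction `F|_Ω`: test functions on `Ω` are extended by zero. -/
def restrict (Ω : Opens ℝ) (F : Distr) : DistrOn Ω :=
  (TestFunction.monoCLM ℝ : TestFn Ω →L[ℝ] TestFn ⊤).precompCompactConvergenceCLM ℝ F

/-- The distributional derivative: `⟨D_x F, t⟩ = -⟨F, t'⟩`. -/
def D : Distr →L[ℝ] Distr := Distribution.lineDerivCLM (1 : ℝ)

theorem D_apply (F : Distr) (t t' : TestFn ⊤) (h : ∀ x, t' x = deriv t x) :
    D F t = -F t' := by
  have : (TestFunction.lineDerivCLM ℝ (1 : ℝ) t : TestFn ⊤) = t' := by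
    ext x
    rw [TestFunction.lineDerivCLM_apply_of_le (by simp), h]
    simp [lineDeriv, deriv_comp_const_add]
  rw [← this]
  exact Distribution.lineDerivCLM_apply

/-- The product `φ t` of a function `φ` smooth on `Ω` and a test function `t` on `Ω`
(extended by `0` outside `Ω`). -/
def mulTest {Ω : Opens ℝ} {φ : ℝ → ℝ} (hφ : ContDiffOn ℝ ∞ φ Ω) (t : TestFn Ω) : TestFn Ω where
  toFun x := φ x * t x
  contDiff' := by
    refine contDiff_iff_contDiffAt.2 fun x => ?_
    by_cases hx : x ∈ Ω
    · exact (hφ.contDiffAt (Ω.isOpen.mem_nhds hx)).mul t.contDiff.contDiffAt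
    · have h0 : (fun x => φ x * t x) =ᶠ[𝓝 x] fun _ => 0 := by
        have hx' : x ∉ tsupport t := fun h => hx (t.tsupport_subset h)
        filter_upwards [notMem_tsupport_iff_eventuallyEq.1 hx'] with y hy
        simp [hy]
      exact contDiffAt_const.congr_of_eventuallyEq h0
  hasCompactSupport' := t.hasCompactSupport.mul_left
  tsupport_subset' := (tsupport_mul_subset_right).trans t.tsupport_subset

/-- Multiplication of test functions on `Ω` by a smooth function on `Ω`, as a continuous map. -/
def mulTestCLM {Ω : Opens ℝ} {φ : ℝ → ℝ} (hφ : ContDiffOn ℝ ∞ φ Ω) : TestFn Ω →L[ℝ] TestFn Ω :=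
  TestFunction.mkCLM ℝ (mulTest hφ)
    (fun f g => by ext x; exact mul_add (φ x) (f x) (g x))
    (fun c f => by ext x; exact mul_left_comm (φ x) c (f x))
    (fun K hK => by
      obtain ⟨χ, h0, h1, -⟩ := exists_contMDiffMap_zero_one_nhds_of_isClosed (n := ⊤)
        (modelWithCornersSelf ℝ ℝ) Ω.isOpen.isClosed_compl K.isCompact.isClosed
        (disjoint_compl_left_iff_subset.2 hK)
      have hg : ContDiff ℝ ∞ (fun x => χ x * φ x) := by
        refine contDiff_iff_contDiffAt.2 fun x => ?_
        by_cases hx : x ∈ Ω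
        · exact χ.contMDiff.contDiff.contDiffAt.mul (hφ.contDiffAt (Ω.isOpen.mem_nhds hx))
        · have hz : (fun x => χ x * φ x) =ᶠ[𝓝 x] fun _ => 0 := by
            filter_upwards [h0.filter_mono (nhds_le_nhdsSet hx)] with y hy
            simp [hy]
          exact contDiffAt_const.congr_of_eventuallyEq hz
      refine ((TestFunction.continuous_ofSupportedIn hK).comp
        (ContDiffMapSupportedIn.bilinLeftCLM (n := ⊤) (K := K) (ContinuousLinearMap.mul ℝ ℝ)
          hg).continuous).congr fun t => ?_
      ext x
      change t x * (χ x * φ x) = φ x * t x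
      by_cases hx : x ∈ K
      · rw [h1.self_of_nhdsSet x hx]
        ring
      · have : t x = 0 := t.zero_on_compl hx
        rw [this]
        ring)

/-- The dual product `φ F` of a smooth function `φ` and a distribution `F` on `Ω`:
`⟨φ F, t⟩ = ⟨F, φ t⟩`. -/
def dualProd {Ω : Opens ℝ} {φ : ℝ → ℝ} (hφ : ContDiffOn ℝ ∞ φ Ω) (F : DistrOn Ω) : DistrOn Ω :=
  (mulTestCLM hφ).precompCompactConvergenceCLM ℝ F

theorem dualProd_apply {Ω : Opens ℝ} {φ : ℝ → ℝ} (hφ : ContDiffOn ℝ ∞ φ Ω) (F : DistrOn Ω)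
    (t : TestFn Ω) : dualProd hφ F t = F (mulTest hφ t) := rfl

/-- The translate `x ↦ t (x - ε)` of a test function. -/
def shiftTest (ε : ℝ) (t : TestFn ⊤) : TestFn ⊤ where
  toFun x := t (x - ε)
  contDiff' := t.contDiff.comp (contDiff_id.sub contDiff_const)
  hasCompactSupport' := t.hasCompactSupport.comp_homeomorph (Homeomorph.subRight ε)
  tsupport_subset' := fun _ _ => trivial

/-- Translation of test functions, as a continuous map. -/
def shiftTestCLM (ε : ℝ) : TestFn ⊤ →L[ℝ] TestFn ⊤ :=
  TestFunction.mkCLM ℝ (shiftTest ε) (fun _ _ => rfl) (fun _ _ => rfl)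
    (fun K _ => by
      let K' : Compacts ℝ := ⟨(fun x => x + ε) '' K, K.isCompact.image (by fun_prop)⟩
      let T : ContDiffMapSupportedIn ℝ ℝ ⊤ K →L[ℝ] ContDiffMapSupportedIn ℝ ℝ ⊤ K' :=
        ContDiffMapSupportedIn.mkCLM ℝ (fun t x => t (x - ε))
          (fun _ _ _ => rfl) (fun _ _ _ => rfl)
          (fun t => t.contDiff.comp (contDiff_id.sub contDiff_const))
          (fun t x hx => t.zero_on_compl fun h => hx ⟨x - ε, h, by simp⟩)
          (fun i hi => ⟨{i}, 1, zero_le_one, fun t x _ => by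
            rw [iteratedFDeriv_comp_sub, Finset.sup_singleton, one_mul]
            exact ContDiffMapSupportedIn.norm_iteratedFDeriv_apply_le_seminorm ℝ hi⟩)
      exact ((TestFunction.continuous_ofSupportedIn (Ω := ⊤) (K := K') fun _ _ => trivial).comp
        T.continuous).congr fun t => rfl)

/-- The translate `F(x + ε)` of a distribution: `⟨F(x + ε), t⟩ = ⟨F, t(x - ε)⟩`. -/
def translate (ε : ℝ) (F : Distr) : Distr :=
  (shiftTestCLM ε).precompCompactConvergenceCLM ℝ F

theorem translate_apply (ε : ℝ) (F : Distr) (t : TestFn ⊤) :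
    translate ε F t = F (shiftTest ε t) := rfl

/-- Convergence `F_i → F` in the sense of distributions, along a filter. -/
def TendstoDistr {ι : Type} (u : ι → Distr) (l : Filter ι) (F : Distr) : Prop :=
  ∀ t : TestFn ⊤, Tendsto (fun i => u i t) l (𝓝 (F t))

/-- On `Ω` the distribution `F` is (given by) the smooth function `φ`. -/
def IsSmoothOn (F : Distr) (Ω : Opens ℝ) (φ : ℝ → ℝ) : Prop :=
  ContDiffOn ℝ ∞ φ Ω ∧ restrict Ω F = regOn Ω φ

/-- The singular support: the points with no open neighbourhood on which `F` is smooth. -/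
def singSupport (F : Distr) : Set ℝ :=
  {x | ¬ ∃ (Ω : Opens ℝ) (φ : ℝ → ℝ), x ∈ Ω ∧ IsSmoothOn F Ω φ}

/-- On `Ω` the distribution `F` is a smooth function `φ`, and `P = φ H` there (dual product). -/
def IsDualProdOn (Ω : Opens ℝ) (F H P : Distr) : Prop :=
  ∃ (φ : ℝ → ℝ) (h : IsSmoothOn F Ω φ), restrict Ω P = dualProd h.1 (restrict Ω H)

/-- `P` is the Hörmander product `F · H` of two distributions with finite disjoint singular
supports: there is a finite open covering of `ℝ` such that on each of its members `F` or `H` is a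
smooth function, and `P` is there the dual product of this function by the other distribution. -/
def IsHormanderProd (F H P : Distr) : Prop :=
  (singSupport F).Finite ∧ (singSupport H).Finite ∧ Disjoint (singSupport F) (singSupport H) ∧
    ∃ (d : ℕ) (Ω : Fin d → Opens ℝ), (⋃ i, (Ω i : Set ℝ)) = univ ∧
      ∀ i, IsDualProdOn (Ω i) F H P ∨ IsDualProdOn (Ω i) H F P

/-- `P = F * H = lim_{ε ↓ 0} F(x) · H(x + ε)`, where `·` is the Hörmander product (which has to
exist for all small `ε > 0`). -/
def IsStarProd (F H P : Distr) : Prop :=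
  ∃ Q : ℝ → Distr, (∀ᶠ ε in 𝓝[>] (0 : ℝ), IsHormanderProd F (translate ε H) (Q ε)) ∧
    TendstoDistr Q (𝓝[>] (0 : ℝ)) P

/-- Piecewise smooth functions: smooth off a finite set `I`, with finite lateral limits of all
derivatives at the points of `I`. -/
def PiecewiseSmooth (f : ℝ → ℝ) : Prop :=
  ∃ I : Finset ℝ, ContDiffOn ℝ ∞ f (I : Set ℝ)ᶜ ∧ ∀ x ∈ I, ∀ n : ℕ,
    (∃ l : ℝ, Tendsto (iteratedDeriv n f) (𝓝[<] x) (𝓝 l)) ∧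
    (∃ l : ℝ, Tendsto (iteratedDeriv n f) (𝓝[>] x) (𝓝 l))

/-- The space `𝓐 = ⋃ᵢ D_xⁱ[C_p^∞]`. -/
def spaceA : Set Distr :=
  {F | ∃ (i : ℕ) (f : ℝ → ℝ), PiecewiseSmooth f ∧ F = (D^[i]) (reg f)}

/-- `F = f + ∑ₓ Δₓ` with `f` piecewise smooth and, for each of the finitely many points `x` of the
support of `Δ`, a nonzero linear combination `Δₓ` of derivatives of the Dirac measure at `x`. -/
def IsDecomp (F : Distr) (f : ℝ → ℝ) (Δ : ℝ →₀ Distr) : Prop :=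
  PiecewiseSmooth f ∧
  (∀ x, Δ x ∈ Submodule.span ℝ
    (range fun j : ℕ => (D^[j]) (Distribution.delta x : Distr))) ∧
  F = reg f + ∑ x ∈ Δ.support, Δ x

/-- `P = F *_M H`. Writing `F = f + ∑ₓ Δₓ` and `H = h + ∑_y Θ_y`, this means
`P = f h + ∑_{y ∈ M} f * Θ_y + ∑_{x ∈ M} Δₓ * h + ∑_{y ∉ M} Θ_y * f + ∑_{x ∉ M} h * Δₓ`. -/
def IsProdM (M : Set ℝ) (F H P : Distr) : Prop :=
  ∃ (f h : ℝ → ℝ) (Δ Θ : ℝ →₀ Distr), IsDecomp F f Δ ∧ IsDecomp H h Θ ∧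
    ∃ p q : ℝ → Distr,
      (∀ y ∈ Θ.support, (y ∈ M → IsStarProd (reg f) (Θ y) (p y)) ∧
        (y ∉ M → IsStarProd (Θ y) (reg f) (p y))) ∧
      (∀ x ∈ Δ.support, (x ∈ M → IsStarProd (Δ x) (reg h) (q x)) ∧
        (x ∉ M → IsStarProd (reg h) (Δ x) (q x))) ∧
      P = reg (fun x => f x * h x) + ∑ y ∈ Θ.support, p y + ∑ x ∈ Δ.support, q x

/-- The conditions on an associative algebra of distributions `(𝓖, +, ⊛)`: `𝓖` is a linear subspace
of `𝓓'`, and `mul` is the bilinear product `⊛` on `𝓖`. -/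
structure IsDistrAlgebra (G : Submodule ℝ Distr) (mul : G →ₗ[ℝ] G →ₗ[ℝ] G) : Prop where
  assoc : ∀ F H J : G, mul (mul F H) J = mul F (mul H J)
  /-- `𝓖` contains the piecewise smooth functions. -/
  piecewiseSmooth_mem : ∀ f : ℝ → ℝ, PiecewiseSmooth f → reg f ∈ G
  /-- The constant function `1` is the identity. -/
  one_mul_and_mul_one : ∀ e : G, (e : Distr) = reg (fun _ => 1) →
    ∀ F : G, mul e F = F ∧ mul F e = F
  /-- There is a linear derivative on `𝓖` that is Leibniz and coincides with `D_x`. -/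
  exists_deriv : ∃ d : G →ₗ[ℝ] G, (∀ F H : G, d (mul F H) = mul (d F) H + mul F (d H)) ∧
    ∀ F : G, (d F : Distr) = D F
  /-- On continuous functions, `⊛` is the usual product. -/
  mul_continuous : ∀ (f h : ℝ → ℝ), Continuous f → Continuous h → ∀ F H : G,
    (F : Distr) = reg f → (H : Distr) = reg h → (mul F H : Distr) = reg (fun x => f x * h x)

/-- Every element of `𝓖` is locally (in a neighbourhood of every point) a finite order derivative of
a continuous function belonging to `𝓖`. -/
def LocallyDerivOfContinuous (G : Submodule ℝ Distr) : Prop :=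
  ∀ F ∈ G, ∀ x : ℝ, ∃ (Ω : Opens ℝ) (k : ℕ) (g : ℝ → ℝ), x ∈ Ω ∧ Continuous g ∧ reg g ∈ G ∧
    restrict Ω F = restrict Ω ((D^[k]) (reg g))

/-- The product by smooth functions is (sequentially) continuous at `F ∈ 𝓖`. -/
def PartiallyContinuousAt {G : Submodule ℝ Distr} (mul : G →ₗ[ℝ] G →ₗ[ℝ] G) (F : G) : Prop :=
  ∀ (ξ : ℝ → ℝ), ContDiff ℝ ∞ ξ → ∀ X : G, (X : Distr) = reg ξ →
    ∀ u : ℕ → G, TendstoDistr (fun n => (u n : Distr)) atTop F →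
      TendstoDistr (fun n => (mul X (u n) : Distr)) atTop (mul X F) ∧
      TendstoDistr (fun n => (mul (u n) X : Distr)) atTop (mul F X)

end

end DistrAlg

/-! The first point is that smooth functions multiply as they should. By hypothesis every F in 𝓖 is
locally a derivative of a continuous function. A partition of unity and uniform approximation
therefore make F the limit of smooth functions uₙ. For a smooth ξ the product ξ ⊛ uₙ is pointwise,
and F - uₙ tends to 0, so partial continuity at zero makes ξ ⊛ F and F ⊛ ξ both equal to the dual
product ξF (`IsDistrAlgebra.smooth_mul`). Topology plays no further part in determining ⊛. What
remains is algebra with associativity and Leibniz, collected in `DerivAlgebra`. Its axioms are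
symmetric, so `DerivAlgebra.flip` gives every one-sided result for the opposite side as well.

Let H be the step at a, and let R = (x - a)H, which is continuous with R' = H. Differentiating R R =
(x - a) R gives H R + R H = 2R. Both terms on the left equal (x - a)(H H), hence (x - a)(H H - H) =
0. A distribution killed by x - a is a multiple of δ (Hadamard's lemma), so H H = H + cδ.
Differentiating once more and multiplying by x - a gives c = 0 (`step_mul_self`). In the same way H
δ = κδ, and H (H δ) = H δ forces κ² = κ. Thus at each point a single binary choice remains
(`step_mul_delta_eq_or`), and M is the set of points with κ = 0. Leibniz on H H = H gives δ H = (1 -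
κ)δ. It follows that all products of derivatives of Dirac measures at one point vanish; smooth
cutoffs separate different points (`delta_mul_delta`).

The choice of κ determines everything on 𝓐. A piecewise smooth f is a continuous function plus
steps, so products of such functions are pointwise (`fn_mul_fn`), and f δ = (f(a-) + κ (f(a+) -
f(a-))) δ. Since products of Dirac terms vanish, Leibniz gives f δ^(j+1) = (f δ^(j))' - f' δ^(j), a
recursion in the one-sided jet of f (`DerivAlgebra.fn_mul_delta`). On the other side, f * δ_y is the
limit of Hörmander products of f with a Dirac measure at y - ε, while δ_y * f uses f(x + ε). The
same recursion computes these products. It depends continuously on the jet and the point, so the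
limits are the values for the left and the right jet, that is, for κ = 0 and κ = 1. -/

namespace DistrAlg

noncomputable section

/-! ### Evaluation of distributions on test functions -/

/-- The derivative of a test function. -/
def derivTest (t : TestFn ⊤) : TestFn ⊤ := TestFunction.lineDerivCLM ℝ (1 : ℝ) t

@[simp]
theorem derivTest_apply (t : TestFn ⊤) (x : ℝ) : derivTest t x = deriv t x := by
  rw [derivTest, TestFunction.lineDerivCLM_apply_of_le (by simp)]
  simp [lineDeriv, deriv_comp_const_add]

theorem D_apply_derivTest (F : Distr) (t : TestFn ⊤) : D F t = -F (derivTest t) :=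
  D_apply F t _ (derivTest_apply t)

/-- The test function with a given underlying smooth compactly supported function. -/
def mkTest (f : ℝ → ℝ) (hf : ContDiff ℝ ∞ f) (hc : HasCompactSupport f) : TestFn ⊤ where
  toFun := f
  contDiff' := hf
  hasCompactSupport' := hc
  tsupport_subset' := fun _ _ => trivial

theorem TestFn.differentiable (t : TestFn ⊤) : Differentiable ℝ t :=
  t.contDiff.differentiable (by simp)

theorem Distr.ext {F H : Distr} (h : ∀ t : TestFn ⊤, F t = H t) : F = H := by
  ext t
  exact h t

@[simp] theorem Distr.add_apply (F H : Distr) (t : TestFn ⊤) : (F + H) t = F t + H t := rfl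
@[simp] theorem Distr.sub_apply (F H : Distr) (t : TestFn ⊤) : (F - H) t = F t - H t := rfl
@[simp] theorem Distr.zero_apply (t : TestFn ⊤) : (0 : Distr) t = 0 := rfl
@[simp] theorem Distr.smul_apply (c : ℝ) (F : Distr) (t : TestFn ⊤) : (c • F) t = c * F t := rfl

theorem Distr.sum_apply {ι : Type*} (s : Finset ι) (F : ι → Distr) (t : TestFn ⊤) :
    (∑ i ∈ s, F i) t = ∑ i ∈ s, F i t := by
  classical
  induction s using Finset.induction_on with
  | empty => rfl
  | insert a s ha ih => rw [Finset.sum_insert ha, Finset.sum_insert ha, Distr.add_apply, ih]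

/-- The Dirac measure at `a`. -/
abbrev dirac (a : ℝ) : Distr := Distribution.delta a

theorem D_iterate_add (j : ℕ) (F H : Distr) : (D^[j]) (F + H) = (D^[j]) F + (D^[j]) H :=
  iterate_map_add D j F H

theorem D_iterate_smul (j : ℕ) (c : ℝ) (F : Distr) : (D^[j]) (c • F) = c • (D^[j]) F := by
  induction j generalizing F with
  | zero => rfl
  | succ j ih => rw [Function.iterate_succ_apply, map_smul, ih, Function.iterate_succ_apply]

/-! ### Multiplication by smooth functions -/

/-- The product of a smooth function on `ℝ` by a distribution. -/
def smoothMul {φ : ℝ → ℝ} (hφ : ContDiff ℝ ∞ φ) (F : Distr) : Distr :=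
  dualProd (Ω := ⊤) hφ.contDiffOn F

theorem smoothMul_apply {φ : ℝ → ℝ} (hφ : ContDiff ℝ ∞ φ) (F : Distr) (t u : TestFn ⊤)
    (h : ∀ x, u x = φ x * t x) : smoothMul hφ F t = F u := by
  rw [smoothMul, dualProd_apply]
  congr 1
  ext x
  exact (h x).symm

/-- The product of a smooth function and a test function. -/
def mulT {φ : ℝ → ℝ} (hφ : ContDiff ℝ ∞ φ) (t : TestFn ⊤) : TestFn ⊤ :=
  mulTest (Ω := ⊤) hφ.contDiffOn t

@[simp]
theorem mulT_apply {φ : ℝ → ℝ} (hφ : ContDiff ℝ ∞ φ) (t : TestFn ⊤) (x : ℝ) :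
    mulT hφ t x = φ x * t x := rfl

theorem smoothMul_apply' {φ : ℝ → ℝ} (hφ : ContDiff ℝ ∞ φ) (F : Distr) (t : TestFn ⊤) :
    smoothMul hφ F t = F (mulT hφ t) := rfl

theorem contDiff_deriv {φ : ℝ → ℝ} (hφ : ContDiff ℝ ∞ φ) : ContDiff ℝ ∞ (deriv φ) :=
  (contDiff_infty_iff_deriv.1 hφ).2

theorem smoothMul_dirac {φ : ℝ → ℝ} (hφ : ContDiff ℝ ∞ φ) (a : ℝ) :
    smoothMul hφ (dirac a) = φ a • dirac a := rfl

theorem D_iterate_dirac_apply (a : ℝ) (j : ℕ) (t : TestFn ⊤) :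
    (D^[j]) (dirac a) t = (-1) ^ j * iteratedDeriv j t a := by
  induction j generalizing t with
  | zero => simp
  | succ j ih =>
    have : (derivTest t : ℝ → ℝ) = deriv t := funext (derivTest_apply t)
    rw [Function.iterate_succ_apply', D_apply_derivTest, ih, iteratedDeriv_succ', this]
    ring

theorem D_iterate_dirac_congr (a : ℝ) (j : ℕ) {t u : TestFn ⊤} (h : (t : ℝ → ℝ) =ᶠ[𝓝 a] u) :
    (D^[j]) (dirac a) t = (D^[j]) (dirac a) u := by
  rw [D_iterate_dirac_apply, D_iterate_dirac_apply, h.iteratedDeriv_eq]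

theorem D_iterate_dirac_eq_zero (a : ℝ) (j : ℕ) {t : TestFn ⊤} (h : ∀ᶠ x in 𝓝 a, t x = 0) :
    (D^[j]) (dirac a) t = 0 := by
  rw [D_iterate_dirac_congr a j (u := 0) h, map_zero]

theorem smoothMul_D_iterate_dirac_of_eq_one {φ : ℝ → ℝ} (hφ : ContDiff ℝ ∞ φ) (a : ℝ) (j : ℕ)
    (h : ∀ᶠ x in 𝓝 a, φ x = 1) : smoothMul hφ ((D^[j]) (dirac a)) = (D^[j]) (dirac a) := by
  refine Distr.ext fun t => D_iterate_dirac_congr a j ?_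
  filter_upwards [h] with x hx
  change φ x * t x = t x
  rw [hx, one_mul]

theorem smoothMul_D_iterate_dirac_of_eq_zero {φ : ℝ → ℝ} (hφ : ContDiff ℝ ∞ φ) (a : ℝ) (j : ℕ)
    (h : ∀ᶠ x in 𝓝 a, φ x = 0) : smoothMul hφ ((D^[j]) (dirac a)) = 0 := by
  refine Distr.ext fun t => D_iterate_dirac_eq_zero a j ?_
  filter_upwards [h] with x hx
  change φ x * t x = 0
  rw [hx, zero_mul]

/-! ### Translations -/

theorem translate_D (ε : ℝ) (F : Distr) : translate ε (D F) = D (translate ε F) := by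
  refine Distr.ext fun t => ?_
  rw [translate_apply, D_apply_derivTest, D_apply_derivTest, translate_apply]
  congr 2
  ext x
  rw [derivTest_apply]
  change deriv (fun y => t (y - ε)) x = derivTest t (x - ε)
  rw [deriv_comp_sub_const, derivTest_apply]

theorem translate_D_iterate_dirac (ε a : ℝ) (j : ℕ) :
    translate ε ((D^[j]) (dirac a)) = (D^[j]) (dirac (a - ε)) := by
  induction j with
  | zero => rfl
  | succ j ih => rw [Function.iterate_succ_apply', translate_D, ih, Function.iterate_succ_apply']

/-! ### Restrictions and gluing -/

theorem restrict_apply (Ω : Opens ℝ) (F : Distr) (t : TestFn Ω) (u : TestFn ⊤)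
    (h : ∀ x, u x = t x) : restrict Ω F t = F u := by
  change F (TestFunction.monoCLM ℝ t) = F u
  congr 1
  ext x
  rw [TestFunction.monoCLM_apply, if_pos ⟨le_rfl, le_top⟩, h]

/-- A test function supported in `Ω`, as a test function on `Ω`. -/
def testOn {Ω : Opens ℝ} (t : TestFn ⊤) (ht : tsupport t ⊆ Ω) : TestFn Ω where
  toFun := t
  contDiff' := t.contDiff
  hasCompactSupport' := t.hasCompactSupport
  tsupport_subset' := ht

/-- A test function on `Ω`, extended by zero. -/
def extendTest {Ω : Opens ℝ} (t : TestFn Ω) : TestFn ⊤ := mkTest t t.contDiff t.hasCompactSupport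

theorem restrict_testOn {Ω : Opens ℝ} (F : Distr) (t : TestFn ⊤) (ht : tsupport t ⊆ Ω) :
    restrict Ω F (testOn t ht) = F t := restrict_apply Ω F _ t fun _ => rfl

theorem restrict_eq_iff {Ω : Opens ℝ} {F : Distr} {T : DistrOn Ω} :
    restrict Ω F = T ↔ ∀ (t : TestFn ⊤) (ht : tsupport t ⊆ Ω), F t = T (testOn t ht) := by
  refine ⟨fun h t ht => by rw [← h, restrict_testOn], fun h => ?_⟩
  ext t
  rw [restrict_apply Ω F t (extendTest t) fun _ => rfl, h (extendTest t) t.tsupport_subset]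
  rfl

theorem restrict_eq_restrict_iff {Ω : Opens ℝ} {F H : Distr} :
    restrict Ω F = restrict Ω H ↔ ∀ t : TestFn ⊤, tsupport t ⊆ Ω → F t = H t := by
  rw [restrict_eq_iff]
  exact forall₂_congr fun t ht => by rw [restrict_testOn]

/-- A smooth partition of unity subordinate to an open covering of `ℝ` splits every test function
into a finite sum. -/
theorem exists_partition (Ω : ℝ → Opens ℝ) (hΩ : ∀ x, x ∈ Ω x) :
    ∃ χ : SmoothPartitionOfUnity ℝ (modelWithCornersSelf ℝ ℝ) ℝ univ,
      (∀ i, tsupport (χ i) ⊆ Ω i) ∧ ∀ t : TestFn ⊤, ∃ s : Finset ℝ,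
        (∀ i ∉ s, ∀ x, χ i x * t x = 0) ∧
        t = ∑ i ∈ s, mulT (χ i).contMDiff.contDiff t := by
  obtain ⟨χ, hχ⟩ := SmoothPartitionOfUnity.exists_isSubordinate (modelWithCornersSelf ℝ ℝ)
    isClosed_univ (fun x => (Ω x : Set ℝ)) (fun x => (Ω x).isOpen)
    (fun x _ => mem_iUnion.2 ⟨x, hΩ x⟩)
  refine ⟨χ, hχ, fun t => ?_⟩
  have hfin := χ.locallyFinite.finite_nonempty_inter_compact t.hasCompactSupport
  have h0 : ∀ i ∉ hfin.toFinset, ∀ x, χ i x * t x = 0 := by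
    intro i hi x
    by_contra hx
    refine hi (hfin.mem_toFinset.2 ⟨x, left_ne_zero_of_mul hx, ?_⟩)
    exact subset_tsupport _ (right_ne_zero_of_mul hx)
  refine ⟨hfin.toFinset, h0, ?_⟩
  ext x
  have hsum : (∑ i ∈ hfin.toFinset, mulT (χ i).contMDiff.contDiff t : TestFn ⊤) x
      = ∑ i ∈ hfin.toFinset, χ i x * t x := by
    have := map_sum (⟨⟨fun u : TestFn ⊤ => u x, rfl⟩, fun _ _ => rfl⟩ : TestFn ⊤ →+ ℝ)
      (fun i => mulT (χ i).contMDiff.contDiff t) hfin.toFinset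
    exact this
  rw [hsum, ← finsum_eq_sum_of_support_subset, ← finsum_mul' _ _ ?_, χ.sum_eq_one (mem_univ x),
    one_mul]
  · exact χ.locallyFinite.point_finite x
  · intro i hi
    by_contra h
    exact hi (h0 i h x)

theorem tsupport_mulT_subset {Ω : Set ℝ} {φ : ℝ → ℝ} (hφ : ContDiff ℝ ∞ φ) (t : TestFn ⊤)
    (h : tsupport φ ⊆ Ω) : tsupport (mulT hφ t) ⊆ Ω :=
  (tsupport_mul_subset_left (f := φ) (g := t)).trans h

/-- A partition of unity splits each test function into finitely many pieces, each supported in one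
set where the two distributions agree. -/
theorem eq_of_locally_eq {F H : Distr}
    (h : ∀ x, ∃ Ω : Opens ℝ, x ∈ Ω ∧ restrict Ω F = restrict Ω H) : F = H := by
  choose Ω hΩ hF using h
  obtain ⟨χ, hχ, hs⟩ := exists_partition Ω hΩ
  refine Distr.ext fun t => ?_
  obtain ⟨s, -, ht⟩ := hs t
  rw [ht, map_sum, map_sum]
  exact Finset.sum_congr rfl fun i _ =>
    restrict_eq_restrict_iff.1 (hF i) _ (tsupport_mulT_subset _ _ (hχ i))

/-! ### Uniqueness of the Hörmander product -/

theorem _root_.ContDiffOn.locallyIntegrableOn_opens {Ω : Opens ℝ} {φ : ℝ → ℝ}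
    (hφ : ContDiffOn ℝ ∞ φ Ω) : LocallyIntegrableOn φ Ω :=
  hφ.continuousOn.locallyIntegrableOn Ω.isOpen.measurableSet

theorem IsSmoothOn.apply {F : Distr} {Ω : Opens ℝ} {φ : ℝ → ℝ} (h : IsSmoothOn F Ω φ)
    (t : TestFn ⊤) (ht : tsupport t ⊆ Ω) : F t = ∫ x, t x * φ x := by
  rw [restrict_eq_iff.1 h.2 t ht, regOn_apply Ω h.1.locallyIntegrableOn_opens]
  rfl

theorem isSmoothOn_iff {F : Distr} {Ω : Opens ℝ} {φ : ℝ → ℝ} : IsSmoothOn F Ω φ ↔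
    ContDiffOn ℝ ∞ φ Ω ∧ ∀ t : TestFn ⊤, tsupport t ⊆ Ω → F t = ∫ x, t x * φ x := by
  refine ⟨fun h => ⟨h.1, h.apply⟩, fun h => ⟨h.1, restrict_eq_iff.2 fun t ht => ?_⟩⟩
  rw [regOn_apply Ω h.1.locallyIntegrableOn_opens, h.2 t ht]
  rfl

theorem IsSmoothOn.mono {F : Distr} {Ω Ω' : Opens ℝ} {φ : ℝ → ℝ} (h : IsSmoothOn F Ω φ)
    (hΩ : Ω' ≤ Ω) : IsSmoothOn F Ω' φ :=
  isSmoothOn_iff.2 ⟨h.1.mono hΩ, fun t ht => h.apply t (ht.trans hΩ)⟩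

/-- The fundamental lemma of the calculus of variations gives equality almost everywhere, and
continuity removes the exceptional set. -/
theorem IsSmoothOn.eqOn {F : Distr} {Ω : Opens ℝ} {φ ψ : ℝ → ℝ} (h : IsSmoothOn F Ω φ)
    (h' : IsSmoothOn F Ω ψ) : EqOn φ ψ Ω := by
  have hl := h.1.locallyIntegrableOn_opens
  have hl' := h'.1.locallyIntegrableOn_opens
  have key := IsOpen.ae_eq_zero_of_integral_contDiff_smul_eq_zero (μ := volume) Ω.isOpen
    (hl.sub hl') fun g hg hc hs => by
      have e1 := h.apply (mkTest g hg hc) hs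
      have e2 := h'.apply (mkTest g hg hc) hs
      have i1 : Integrable fun x => g x * φ x := TestFunction.integrable_bilin (ContinuousLinearMap.mul ℝ ℝ) hl
        (testOn (mkTest g hg hc) hs)
      have i2 : Integrable fun x => g x * ψ x := TestFunction.integrable_bilin (ContinuousLinearMap.mul ℝ ℝ) hl'
        (testOn (mkTest g hg hc) hs)
      have : ∀ x, g x • (φ - ψ) x = g x * φ x - g x * ψ x := fun x => by
        simp [mul_sub]
      simp_rw [this]
      rw [integral_sub i1 i2, sub_eq_zero]
      exact e1.symm.trans e2
  refine Measure.eqOn_open_of_ae_eq (μ := volume) ?_ Ω.isOpen h.1.continuousOn h'.1.continuousOn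
  refine (ae_restrict_iff' Ω.isOpen.measurableSet).2 ?_
  filter_upwards [key] with x hx hxΩ
  exact sub_eq_zero.1 (hx hxΩ)

theorem isDualProdOn_iff {Ω : Opens ℝ} {F H P : Distr} : IsDualProdOn Ω F H P ↔
    ∃ φ : ℝ → ℝ, IsSmoothOn F Ω φ ∧ ∀ t u : TestFn ⊤, tsupport t ⊆ Ω →
      (∀ x, u x = φ x * t x) → P t = H u := by
  constructor
  · rintro ⟨φ, h, hP⟩
    refine ⟨φ, h, fun t u ht hu => ?_⟩
    rw [restrict_eq_iff.1 hP t ht, dualProd_apply]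
    exact restrict_apply Ω H _ u hu
  · rintro ⟨φ, h, hP⟩
    refine ⟨φ, h, restrict_eq_iff.2 fun t ht => ?_⟩
    rw [dualProd_apply, hP t (extendTest (mulTest h.1 (testOn t ht))) ht fun x => rfl]
    exact (restrict_apply Ω H _ _ fun _ => rfl).symm

theorem IsDualProdOn.mono {Ω Ω' : Opens ℝ} {F H P : Distr} (h : IsDualProdOn Ω F H P)
    (hΩ : Ω' ≤ Ω) : IsDualProdOn Ω' F H P := by
  obtain ⟨φ, h1, h2⟩ := isDualProdOn_iff.1 h
  exact isDualProdOn_iff.2 ⟨φ, h1.mono hΩ, fun t u ht hu => h2 t u (ht.trans hΩ) hu⟩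

/-- The product of a smooth function on `Ω` and a test function supported in `Ω`. -/
def mulOn {Ω : Opens ℝ} {φ : ℝ → ℝ} (hφ : ContDiffOn ℝ ∞ φ Ω) (t : TestFn ⊤)
    (ht : tsupport t ⊆ Ω) : TestFn ⊤ := extendTest (mulTest hφ (testOn t ht))

theorem mulOn_apply {Ω : Opens ℝ} {φ : ℝ → ℝ} (hφ : ContDiffOn ℝ ∞ φ Ω) (t : TestFn ⊤)
    (ht : tsupport t ⊆ Ω) (x : ℝ) : mulOn hφ t ht x = φ x * t x := rfl

theorem tsupport_mulOn_subset {Ω : Opens ℝ} {φ : ℝ → ℝ} (hφ : ContDiffOn ℝ ∞ φ Ω) (t : TestFn ⊤)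
    (ht : tsupport t ⊆ Ω) : tsupport (mulOn hφ t ht) ⊆ Ω :=
  (tsupport_mul_subset_right (f := φ) (g := t)).trans ht

theorem IsDualProdOn.unique_left {Ω : Opens ℝ} {F H P P' : Distr} (h : IsDualProdOn Ω F H P)
    (h' : IsDualProdOn Ω F H P') : restrict Ω P = restrict Ω P' := by
  obtain ⟨φ, h1, h2⟩ := isDualProdOn_iff.1 h
  obtain ⟨ψ, h3, h4⟩ := isDualProdOn_iff.1 h'
  refine restrict_eq_restrict_iff.2 fun t ht => ?_
  rw [h2 t (mulOn h1.1 t ht) ht fun _ => rfl, h4 t (mulOn h1.1 t ht) ht fun x => ?_]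
  rw [mulOn_apply]
  by_cases hx : x ∈ Ω
  · rw [h1.eqOn h3 hx]
  · have : t x = 0 := by
      by_contra hne
      exact hx (ht (subset_tsupport _ hne))
    simp [this]

/-- Here both factors are smooth on Ω, by φ and ψ, and both products are integration against φψ. -/
theorem IsDualProdOn.unique_cross {Ω : Opens ℝ} {F H P P' : Distr} (h : IsDualProdOn Ω F H P)
    (h' : IsDualProdOn Ω H F P') : restrict Ω P = restrict Ω P' := by
  obtain ⟨φ, h1, h2⟩ := isDualProdOn_iff.1 h
  obtain ⟨ψ, h3, h4⟩ := isDualProdOn_iff.1 h'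
  refine restrict_eq_restrict_iff.2 fun t ht => ?_
  rw [h2 t (mulOn h1.1 t ht) ht fun _ => rfl, h4 t (mulOn h3.1 t ht) ht fun _ => rfl,
    h3.apply _ (tsupport_mulOn_subset h1.1 t ht), h1.apply _ (tsupport_mulOn_subset h3.1 t ht)]
  congr 1
  ext x
  rw [mulOn_apply, mulOn_apply]
  ring

/-- The coverings may differ, and so may the factor that is smooth. On the intersection of two
members either case is settled by `unique_left` or `unique_cross`. -/
theorem IsHormanderProd.unique {F H P P' : Distr} (h : IsHormanderProd F H P)
    (h' : IsHormanderProd F H P') : P = P' := by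
  obtain ⟨-, -, -, d, Ω, hΩ, hP⟩ := h
  obtain ⟨-, -, -, d', Ω', hΩ', hP'⟩ := h'
  refine eq_of_locally_eq fun x => ?_
  obtain ⟨i, hi⟩ := mem_iUnion.1 (hΩ.symm ▸ mem_univ x)
  obtain ⟨j, hj⟩ := mem_iUnion.1 (hΩ'.symm ▸ mem_univ x)
  refine ⟨Ω i ⊓ Ω' j, ⟨hi, hj⟩, ?_⟩
  have hl : Ω i ⊓ Ω' j ≤ Ω i := inf_le_left
  have hr : Ω i ⊓ Ω' j ≤ Ω' j := inf_le_right
  rcases hP i with h1 | h1 <;> rcases hP' j with h2 | h2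
  · exact (h1.mono hl).unique_left (h2.mono hr)
  · exact (h1.mono hl).unique_cross (h2.mono hr)
  · exact (h1.mono hl).unique_cross (h2.mono hr)
  · exact (h1.mono hl).unique_left (h2.mono hr)

theorem IsStarProd.unique {F H P P' : Distr} (h : IsStarProd F H P) (h' : IsStarProd F H P') :
    P = P' := by
  obtain ⟨Q, hQ, hP⟩ := h
  obtain ⟨Q', hQ', hP'⟩ := h'
  refine Distr.ext fun t => tendsto_nhds_unique (hP t) ((hP' t).congr' ?_)
  filter_upwards [hQ, hQ'] with ε h1 h2
  rw [h1.unique h2]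

theorem IsHormanderProd.symm {F H P : Distr} (h : IsHormanderProd F H P) :
    IsHormanderProd H F P := by
  obtain ⟨h1, h2, h3, d, Ω, hΩ, hP⟩ := h
  exact ⟨h2, h1, h3.symm, d, Ω, hΩ, fun i => (hP i).symm⟩

/-! ### Distributions annihilated by `x - a` -/

/-- Each derivative in x brings down a factor u. The weight u ^ k makes this family of integrals
closed under differentiation, which is what the induction for smoothness needs. -/
theorem hasDerivAt_integral_pow_mul {g : ℝ → ℝ} (hg : ContDiff ℝ ∞ g) (a : ℝ) (k : ℕ) (x : ℝ) :
    HasDerivAt (fun x => ∫ u in (0 : ℝ)..1, u ^ k * g (a + u * (x - a)))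
      (∫ u in (0 : ℝ)..1, u ^ (k + 1) * deriv g (a + u * (x - a))) x := by
  have hg' : Continuous (deriv g) := (contDiff_deriv hg).continuous
  have hgc : Continuous g := hg.continuous
  have hcont : Continuous fun p : ℝ × ℝ => p.2 ^ (k + 1) * deriv g (a + p.2 * (p.1 - a)) := by
    fun_prop
  obtain ⟨C, hC⟩ := ((isCompact_Icc (a := x - 1) (b := x + 1)).prod
    (isCompact_Icc (a := (0 : ℝ)) (b := 1))).exists_bound_of_continuousOn hcont.continuousOn
  refine (intervalIntegral.hasDerivAt_integral_of_dominated_loc_of_deriv_le (𝕜 := ℝ)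
    (s := Icc (x - 1) (x + 1)) (bound := fun _ => C)
    (F' := fun x u => u ^ (k + 1) * deriv g (a + u * (x - a)))
    (Icc_mem_nhds (by linarith) (by linarith)) ?_ ?_ ?_ ?_ ?_ ?_).2
  · exact Eventually.of_forall fun y =>
      (by fun_prop : Continuous fun u => u ^ k * g (a + u * (y - a))).aestronglyMeasurable
  · exact (by fun_prop : Continuous fun u => u ^ k * g (a + u * (x - a))).intervalIntegrable _ _
  · exact (by fun_prop :
      Continuous fun u => u ^ (k + 1) * deriv g (a + u * (x - a))).aestronglyMeasurable
  · refine Eventually.of_forall fun u hu y hy => hC (y, u) ⟨hy, ?_⟩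
    rw [uIoc_of_le zero_le_one] at hu
    exact ⟨hu.1.le, hu.2⟩
  · exact intervalIntegrable_const
  · refine Eventually.of_forall fun u _ y _ => ?_
    have h1 : HasDerivAt (fun y => a + u * (y - a)) u y := by
      simpa using (((hasDerivAt_id y).sub_const a).const_mul u).const_add a
    have h2 := ((hg.differentiable (by simp) (a + u * (y - a))).hasDerivAt.comp y h1).const_mul
      (u ^ k)
    exact h2.congr_deriv (by ring)

theorem contDiff_integral_pow_mul {g : ℝ → ℝ} (hg : ContDiff ℝ ∞ g) (a : ℝ) (k : ℕ) :
    ContDiff ℝ ∞ (fun x => ∫ u in (0 : ℝ)..1, u ^ k * g (a + u * (x - a))) := by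
  refine contDiff_infty.2 fun n => ?_
  induction n generalizing g k with
  | zero =>
    exact contDiff_zero.2 (Differentiable.continuous (𝕜 := ℝ) fun x =>
      (hasDerivAt_integral_pow_mul hg a k x).differentiableAt)
  | succ n ih =>
    have := contDiff_succ_iff_deriv (𝕜 := ℝ) (n := n)
      (f := fun x => ∫ u in (0 : ℝ)..1, u ^ k * g (a + u * (x - a)))
    refine this.2 ⟨fun x => (hasDerivAt_integral_pow_mul hg a k x).differentiableAt, by simp, ?_⟩
    rw [funext fun x => (hasDerivAt_integral_pow_mul hg a k x).deriv]
    exact ih (contDiff_deriv hg) (k + 1)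

/-- Hadamard's lemma: a smooth function vanishing at `a` is divisible by `x - a`. -/
theorem exists_contDiff_eq_sub_mul {f : ℝ → ℝ} (hf : ContDiff ℝ ∞ f) {a : ℝ} (ha : f a = 0) :
    ∃ s : ℝ → ℝ, ContDiff ℝ ∞ s ∧ ∀ x, f x = (x - a) * s x := by
  -- The quotient is ∫₀¹ f'(a + u (x - a)) du, the case k = 0 with g = f'.
  refine ⟨_, contDiff_integral_pow_mul (contDiff_deriv hf) a 0, fun x => ?_⟩
  have hder : ∀ u ∈ uIcc (0 : ℝ) 1, HasDerivAt (fun u => f (a + u * (x - a)))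
      (deriv f (a + u * (x - a)) * (x - a)) u := fun u _ => by
    have h1 : HasDerivAt (fun u => a + u * (x - a)) (x - a) u := by
      simpa using ((hasDerivAt_id u).mul_const (x - a)).const_add a
    exact (hf.differentiable (by simp) (a + u * (x - a))).hasDerivAt.comp u h1
  have hf' : Continuous (deriv f) := (contDiff_deriv hf).continuous
  have := intervalIntegral.integral_eq_sub_of_hasDerivAt hder
    ((by fun_prop : Continuous fun u => deriv f (a + u * (x - a)) * (x - a)).intervalIntegrable _ _)
  rw [intervalIntegral.integral_mul_const] at this
  simp only [one_mul, zero_mul, add_zero, add_sub_cancel, ha, sub_zero] at this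
  simp only [pow_zero, one_mul]
  rw [← this, mul_comm]

theorem contDiff_sub_const (a : ℝ) : ContDiff ℝ ∞ fun x : ℝ => x - a :=
  contDiff_id.sub contDiff_const

/-- Away from a the Hadamard quotient vanishes wherever t does, so it has compact support too. -/
theorem exists_test_eq_sub_mul (t : TestFn ⊤) {a : ℝ} (ha : t a = 0) :
    ∃ s : TestFn ⊤, t = mulT (contDiff_sub_const a) s := by
  obtain ⟨s, hs, h⟩ := exists_contDiff_eq_sub_mul t.contDiff ha
  refine ⟨mkTest s hs ?_, by ext x; exact h x⟩
  refine HasCompactSupport.of_support_subset_isCompact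
    (K := tsupport t ∪ {a}) (t.hasCompactSupport.isCompact.union isCompact_singleton) ?_
  intro x hx
  by_cases hxa : x = a
  · exact Or.inr hxa
  · refine Or.inl (subset_tsupport _ ?_)
    rw [Function.mem_support, h]
    exact mul_ne_zero (sub_ne_zero.2 hxa) hx

theorem exists_test_eq_one (a : ℝ) : ∃ χ : TestFn ⊤, χ a = 1 := by
  let b : ContDiffBump a := default
  exact ⟨mkTest b b.contDiff b.hasCompactSupport,
    b.one_of_mem_closedBall (Metric.mem_closedBall_self b.rIn_pos.le)⟩

/-- With χ(a) = 1, the test function t - t(a) χ vanishes at a, hence is divisible by x - a and is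
killed by F. Thus F t = F(χ) t(a). -/
theorem exists_eq_smul_dirac {F : Distr} {a : ℝ} (h : smoothMul (contDiff_sub_const a) F = 0) :
    ∃ c : ℝ, F = c • dirac a := by
  obtain ⟨χ, hχ⟩ := exists_test_eq_one a
  refine ⟨F χ, Distr.ext fun t => ?_⟩
  obtain ⟨s, hs⟩ := exists_test_eq_sub_mul (t - t a • χ) (a := a) (by
    change t a - t a * χ a = 0
    rw [hχ]
    ring)
  have h0 : F (t - t a • χ) = 0 := by
    rw [hs, ← smoothMul_apply', h]
    rfl
  rw [map_sub, map_smul, sub_eq_zero] at h0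
  rw [h0]
  change t a * F χ = F χ * t a
  ring

theorem dirac_ne_zero (a : ℝ) : dirac a ≠ 0 := by
  obtain ⟨χ, hχ⟩ := exists_test_eq_one a
  intro h
  have : dirac a χ = 0 := by rw [h]; rfl
  rw [Distribution.delta_apply, hχ] at this
  exact one_ne_zero this

/-! ### Piecewise smooth functions -/

/-- Along the filter `l`, the function `f` is smooth and all its derivatives have finite limits. -/
def HasJets (f : ℝ → ℝ) (l : Filter ℝ) : Prop :=
  (∀ᶠ y in l, ContDiffAt ℝ ∞ f y) ∧ ∀ n : ℕ, ∃ c : ℝ, Tendsto (iteratedDeriv n f) l (𝓝 c)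

theorem contDiffAt_natCast {f : ℝ → ℝ} {x : ℝ} (h : ContDiffAt ℝ ∞ f x) (n : ℕ) :
    ContDiffAt ℝ n f x := h.of_le (by exact_mod_cast le_top)

theorem contDiffAt_deriv {f : ℝ → ℝ} {x : ℝ} (h : ContDiffAt ℝ ∞ f x) :
    ContDiffAt ℝ ∞ (deriv f) x := h.derivWithin (by simp)

theorem HasJets.mul {f g : ℝ → ℝ} {l : Filter ℝ} (hf : HasJets f l) (hg : HasJets g l) :
    HasJets (fun x => f x * g x) l := by
  refine ⟨by filter_upwards [hf.1, hg.1] with y h1 h2 using h1.mul h2, fun n => ?_⟩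
  choose a ha using hf.2
  choose b hb using hg.2
  refine ⟨∑ i ∈ Finset.range (n + 1), (n.choose i : ℝ) * a i * b (n - i), ?_⟩
  refine (tendsto_finsetSum _ fun i _ => ((ha i).const_mul _).mul (hb (n - i))).congr' ?_
  filter_upwards [hf.1, hg.1] with y h1 h2
  exact (iteratedDeriv_mul (contDiffAt_natCast h1 n) (contDiffAt_natCast h2 n)).symm

theorem HasJets.add {f g : ℝ → ℝ} {l : Filter ℝ} (hf : HasJets f l) (hg : HasJets g l) :
    HasJets (fun x => f x + g x) l := by
  refine ⟨by filter_upwards [hf.1, hg.1] with y h1 h2 using h1.add h2, fun n => ?_⟩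
  obtain ⟨a, ha⟩ := hf.2 n
  obtain ⟨b, hb⟩ := hg.2 n
  refine ⟨a + b, (ha.add hb).congr' ?_⟩
  filter_upwards [hf.1, hg.1] with y h1 h2
  exact (iteratedDeriv_add (contDiffAt_natCast h1 n) (contDiffAt_natCast h2 n)).symm

theorem continuousAt_iteratedDeriv {f : ℝ → ℝ} {x : ℝ} (hf : ContDiffAt ℝ ∞ f x) (n : ℕ) :
    ContinuousAt (iteratedDeriv n f) x := by
  have h1 : ContinuousAt (iteratedFDeriv ℝ n f) x :=
    hf.continuousAt_iteratedFDeriv (by exact_mod_cast le_top)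
  rw [iteratedDeriv_eq_equiv_comp]
  exact ((ContinuousMultilinearMap.piFieldEquiv ℝ (Fin n) ℝ).symm.continuous.continuousAt).comp h1

theorem HasJets.of_eventually {f : ℝ → ℝ} {x : ℝ} (hf : ∀ᶠ y in 𝓝 x, ContDiffAt ℝ ∞ f y)
    {l : Filter ℝ} (hl : l ≤ 𝓝 x) : HasJets f l :=
  ⟨hf.filter_mono hl, fun n => ⟨iteratedDeriv n f x,
    (continuousAt_iteratedDeriv hf.self_of_nhds n).tendsto.mono_left hl⟩⟩

theorem HasJets.of_contDiff {f : ℝ → ℝ} (hf : ContDiff ℝ ∞ f) {l : Filter ℝ} (x : ℝ)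
    (hl : l ≤ 𝓝 x) : HasJets f l :=
  HasJets.of_eventually (Eventually.of_forall fun _ => hf.contDiffAt) hl

theorem HasJets.congr {f g : ℝ → ℝ} {l : Filter ℝ} (hf : HasJets f l)
    (h : ∀ᶠ y in l, f =ᶠ[𝓝 y] g) : HasJets g l := by
  refine ⟨by filter_upwards [hf.1, h] with y h1 h2 using h1.congr_of_eventuallyEq h2.symm,
    fun n => ?_⟩
  obtain ⟨a, ha⟩ := hf.2 n
  refine ⟨a, ha.congr' ?_⟩
  filter_upwards [h] with y h1 using h1.iteratedDeriv_eq n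

protected theorem HasJets.deriv {f : ℝ → ℝ} {l : Filter ℝ} (hf : HasJets f l) :
    HasJets (deriv f) l := by
  refine ⟨by filter_upwards [hf.1] with y h1 using contDiffAt_deriv h1, fun n => ?_⟩
  rw [← iteratedDeriv_succ']
  exact hf.2 (n + 1)

theorem isOpen_compl_finset (I : Finset ℝ) : IsOpen ((I : Set ℝ)ᶜ) :=
  I.finite_toSet.isClosed.isOpen_compl

theorem eventually_notMem {I : Finset ℝ} {x : ℝ} (hx : x ∉ I) : ∀ᶠ y in 𝓝 x, y ∉ I :=
  (isOpen_compl_finset I).mem_nhds hx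

theorem eventually_ne_notMem (I : Finset ℝ) (x : ℝ) : ∀ᶠ y in 𝓝[≠] x, y ∉ I := by
  have h : ∀ᶠ y in 𝓝 x, y ∉ I.erase x := eventually_notMem (Finset.notMem_erase x I)
  filter_upwards [h.filter_mono nhdsWithin_le_nhds, self_mem_nhdsWithin] with y h1 h2 h3
  exact h1 (Finset.mem_erase.2 ⟨h2, h3⟩)

theorem eventually_lt_notMem (I : Finset ℝ) (x : ℝ) : ∀ᶠ y in 𝓝[<] x, y ∉ I :=
  (eventually_ne_notMem I x).filter_mono (nhdsWithin_mono x fun _ h => ne_of_lt h)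

theorem eventually_gt_notMem (I : Finset ℝ) (x : ℝ) : ∀ᶠ y in 𝓝[>] x, y ∉ I :=
  (eventually_ne_notMem I x).filter_mono (nhdsWithin_mono x fun _ h => ne_of_gt h)

/-- A function which is smooth off the finite set `I` and has lateral limits of all orders. -/
def SmoothOff (I : Finset ℝ) (f : ℝ → ℝ) : Prop :=
  (∀ x ∉ I, ContDiffAt ℝ ∞ f x) ∧ ∀ x, HasJets f (𝓝[<] x) ∧ HasJets f (𝓝[>] x)

/-- Asking for lateral jets at every point, not only on I, costs nothing and lets I be enlarged, so
that several functions can share one exceptional set. -/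
theorem piecewiseSmooth_iff {f : ℝ → ℝ} : PiecewiseSmooth f ↔ ∃ I, SmoothOff I f := by
  constructor
  · rintro ⟨I, h1, h2⟩
    have h3 : ∀ x ∉ I, ContDiffAt ℝ ∞ f x := fun x hx =>
      h1.contDiffAt ((isOpen_compl_finset I).mem_nhds hx)
    refine ⟨I, h3, fun x => ?_⟩
    by_cases hx : x ∈ I
    · exact ⟨⟨(eventually_lt_notMem I x).mono h3, fun n => (h2 x hx n).1⟩,
        ⟨(eventually_gt_notMem I x).mono h3, fun n => (h2 x hx n).2⟩⟩
    · have := (eventually_notMem hx).mono h3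
      exact ⟨.of_eventually this nhdsWithin_le_nhds, .of_eventually this nhdsWithin_le_nhds⟩
  · rintro ⟨I, h1, h2⟩
    exact ⟨I, fun x hx => (h1 x hx).contDiffWithinAt,
      fun x _ n => ⟨(h2 x).1.2 n, (h2 x).2.2 n⟩⟩

theorem SmoothOff.piecewiseSmooth {I : Finset ℝ} {f : ℝ → ℝ} (h : SmoothOff I f) :
    PiecewiseSmooth f := piecewiseSmooth_iff.2 ⟨I, h⟩

theorem SmoothOff.mono {I J : Finset ℝ} {f : ℝ → ℝ} (h : SmoothOff I f) (hIJ : I ⊆ J) :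
    SmoothOff J f := ⟨fun x hx => h.1 x fun hI => hx (hIJ hI), h.2⟩

theorem SmoothOff.mul {I : Finset ℝ} {f g : ℝ → ℝ} (hf : SmoothOff I f) (hg : SmoothOff I g) :
    SmoothOff I fun x => f x * g x :=
  ⟨fun x hx => (hf.1 x hx).mul (hg.1 x hx),
    fun x => ⟨(hf.2 x).1.mul (hg.2 x).1, (hf.2 x).2.mul (hg.2 x).2⟩⟩

theorem SmoothOff.add {I : Finset ℝ} {f g : ℝ → ℝ} (hf : SmoothOff I f) (hg : SmoothOff I g) :
    SmoothOff I fun x => f x + g x :=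
  ⟨fun x hx => (hf.1 x hx).add (hg.1 x hx),
    fun x => ⟨(hf.2 x).1.add (hg.2 x).1, (hf.2 x).2.add (hg.2 x).2⟩⟩

protected theorem SmoothOff.deriv {I : Finset ℝ} {f : ℝ → ℝ} (hf : SmoothOff I f) : SmoothOff I (deriv f) :=
  ⟨fun x hx => contDiffAt_deriv (hf.1 x hx), fun x => ⟨(hf.2 x).1.deriv, (hf.2 x).2.deriv⟩⟩

theorem SmoothOff.of_contDiff {f : ℝ → ℝ} (hf : ContDiff ℝ ∞ f) (I : Finset ℝ) : SmoothOff I f :=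
  ⟨fun _ _ => hf.contDiffAt, fun x =>
    ⟨.of_contDiff hf x nhdsWithin_le_nhds, .of_contDiff hf x nhdsWithin_le_nhds⟩⟩

theorem SmoothOff.const_mul {I : Finset ℝ} {f : ℝ → ℝ} (c : ℝ) (hf : SmoothOff I f) :
    SmoothOff I fun x => c * f x := (SmoothOff.of_contDiff contDiff_const I).mul hf

theorem SmoothOff.sum {ι : Type*} {I : Finset ℝ} (s : Finset ι) {f : ι → ℝ → ℝ}
    (hf : ∀ i ∈ s, SmoothOff I (f i)) : SmoothOff I fun x => ∑ i ∈ s, f i x := by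
  classical
  induction s using Finset.induction_on with
  | empty => simpa using SmoothOff.of_contDiff (contDiff_const (c := (0 : ℝ))) I
  | insert a s ha ih =>
    simp_rw [Finset.sum_insert ha]
    exact (hf a (Finset.mem_insert_self a s)).add
      (ih fun i hi => hf i (Finset.mem_insert_of_mem hi))

theorem SmoothOff.congr {I : Finset ℝ} {f g : ℝ → ℝ} (hf : SmoothOff I f)
    (h : ∀ x ∉ I, f x = g x) : SmoothOff I g := by
  have h' : ∀ x ∉ I, f =ᶠ[𝓝 x] g := fun x hx => (eventually_notMem hx).mono h
  exact ⟨fun x hx => (hf.1 x hx).congr_of_eventuallyEq (h' x hx).symm, fun x =>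
    ⟨(hf.2 x).1.congr ((eventually_lt_notMem I x).mono h'),
      (hf.2 x).2.congr ((eventually_gt_notMem I x).mono h')⟩⟩

theorem PiecewiseSmooth.exists_common {f g : ℝ → ℝ} (hf : PiecewiseSmooth f)
    (hg : PiecewiseSmooth g) : ∃ I, SmoothOff I f ∧ SmoothOff I g := by
  classical
  obtain ⟨I, hI⟩ := piecewiseSmooth_iff.1 hf
  obtain ⟨J, hJ⟩ := piecewiseSmooth_iff.1 hg
  exact ⟨I ∪ J, hI.mono Finset.subset_union_left, hJ.mono Finset.subset_union_right⟩

theorem PiecewiseSmooth.mul {f g : ℝ → ℝ} (hf : PiecewiseSmooth f) (hg : PiecewiseSmooth g) :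
    PiecewiseSmooth fun x => f x * g x := by
  obtain ⟨I, h1, h2⟩ := hf.exists_common hg
  exact (h1.mul h2).piecewiseSmooth

theorem PiecewiseSmooth.add {f g : ℝ → ℝ} (hf : PiecewiseSmooth f) (hg : PiecewiseSmooth g) :
    PiecewiseSmooth fun x => f x + g x := by
  obtain ⟨I, h1, h2⟩ := hf.exists_common hg
  exact (h1.add h2).piecewiseSmooth

protected theorem PiecewiseSmooth.deriv {f : ℝ → ℝ} (hf : PiecewiseSmooth f) : PiecewiseSmooth (deriv f) := by
  obtain ⟨I, h⟩ := piecewiseSmooth_iff.1 hf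
  exact h.deriv.piecewiseSmooth

theorem _root_.ContDiff.piecewiseSmooth {f : ℝ → ℝ} (hf : ContDiff ℝ ∞ f) : PiecewiseSmooth f :=
  (SmoothOff.of_contDiff hf ∅).piecewiseSmooth

theorem PiecewiseSmooth.const_mul {f : ℝ → ℝ} (c : ℝ) (hf : PiecewiseSmooth f) :
    PiecewiseSmooth fun x => c * f x := contDiff_const.piecewiseSmooth.mul hf

theorem SmoothOff.aestronglyMeasurable {I : Finset ℝ} {f : ℝ → ℝ} (h : SmoothOff I f) :
    AEStronglyMeasurable f volume := by
  have h1 : ContinuousOn f (I : Set ℝ)ᶜ := fun x hx => (h.1 x hx).continuousAt.continuousWithinAt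
  have h2 := h1.aestronglyMeasurable (μ := volume) (isOpen_compl_finset I).measurableSet
  rwa [Measure.restrict_eq_self_of_ae_mem] at h2
  exact compl_mem_ae_iff.2 (I.finite_toSet.measure_zero volume)

/-- The finite limits on either side of a point give integrability there, and the point itself is
null. -/
theorem PiecewiseSmooth.locallyIntegrable {f : ℝ → ℝ} (hf : PiecewiseSmooth f) :
    LocallyIntegrable f volume := by
  obtain ⟨I, h⟩ := piecewiseSmooth_iff.1 hf
  intro x
  have key : ∀ s : Set ℝ, HasJets f (𝓝[s] x) → MeasurableSet s →
      IntegrableAtFilter f (𝓝[s] x) volume := by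
    intro s hs hm
    obtain ⟨c, hc⟩ := hs.2 0
    have := hm.nhdsWithin_isMeasurablyGenerated x
    rw [iteratedDeriv_zero] at hc
    exact (hc.mono_left inf_le_left).integrableAtFilter_ae
      ⟨univ, univ_mem, h.aestronglyMeasurable.restrict⟩ (volume.finiteAt_nhdsWithin x s)
  have h1 : IntegrableAtFilter f (𝓝[≠] x) volume := by
    rw [← nhdsLT_sup_nhdsGT]
    exact IntegrableAtFilter.sup_iff.2 ⟨key _ (h.2 x).1 measurableSet_Iio,
      key _ (h.2 x).2 measurableSet_Ioi⟩
  obtain ⟨s, hs, hi⟩ := h1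
  refine ⟨insert x s, insert_mem_nhds_iff.2 hs, ?_⟩
  rw [insert_eq]
  refine IntegrableOn.union ?_ hi
  rw [IntegrableOn, Measure.restrict_eq_zero.2 Real.volume_singleton]
  exact integrable_zero_measure

/-! ### Lateral limits -/

/-- The limit of `f` at `x` from the left. -/
def leftVal (f : ℝ → ℝ) (x : ℝ) : ℝ := limUnder (𝓝[<] x) f

/-- The limit of `f` at `x` from the right. -/
def rightVal (f : ℝ → ℝ) (x : ℝ) : ℝ := limUnder (𝓝[>] x) f

theorem PiecewiseSmooth.tendsto_left {f : ℝ → ℝ} (hf : PiecewiseSmooth f) (x : ℝ) :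
    Tendsto f (𝓝[<] x) (𝓝 (leftVal f x)) := by
  obtain ⟨I, h⟩ := piecewiseSmooth_iff.1 hf
  exact tendsto_nhds_limUnder (by simpa using (h.2 x).1.2 0)

theorem PiecewiseSmooth.tendsto_right {f : ℝ → ℝ} (hf : PiecewiseSmooth f) (x : ℝ) :
    Tendsto f (𝓝[>] x) (𝓝 (rightVal f x)) := by
  obtain ⟨I, h⟩ := piecewiseSmooth_iff.1 hf
  exact tendsto_nhds_limUnder (by simpa using (h.2 x).2.2 0)

protected theorem PiecewiseSmooth.iteratedDeriv {f : ℝ → ℝ} (hf : PiecewiseSmooth f) (n : ℕ) :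
    PiecewiseSmooth (iteratedDeriv n f) := by
  induction n generalizing f with
  | zero => simpa using hf
  | succ n ih =>
    rw [iteratedDeriv_succ']
    exact ih hf.deriv

theorem leftVal_eq {f : ℝ → ℝ} {x c : ℝ} (h : Tendsto f (𝓝[<] x) (𝓝 c)) : leftVal f x = c :=
  h.limUnder_eq

/-- The jump of `f` at `x`. -/
def jump (f : ℝ → ℝ) (x : ℝ) : ℝ := rightVal f x - leftVal f x

/-- The indicator function of `(a, ∞)`. -/
def heaviside (a : ℝ) : ℝ → ℝ := fun x => if a < x then 1 else 0

theorem heaviside_of_lt {a x : ℝ} (h : a < x) : heaviside a x = 1 := if_pos h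

theorem heaviside_of_le {a x : ℝ} (h : x ≤ a) : heaviside a x = 0 := if_neg h.not_gt

theorem heaviside_eventually_of_lt {a x : ℝ} (h : a < x) :
    heaviside a =ᶠ[𝓝 x] fun _ => 1 := by
  filter_upwards [Ioi_mem_nhds h] with y hy using heaviside_of_lt hy

theorem heaviside_eventually_of_gt {a x : ℝ} (h : x < a) :
    heaviside a =ᶠ[𝓝 x] fun _ => 0 := by
  filter_upwards [Iio_mem_nhds h] with y hy using heaviside_of_le hy.le

theorem smoothOff_heaviside (a : ℝ) : SmoothOff {a} (heaviside a) := by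
  have hlt : ∀ x, a < x → ContDiffAt ℝ ∞ (heaviside a) x := fun x h =>
    contDiffAt_const.congr_of_eventuallyEq (heaviside_eventually_of_lt h)
  have hgt : ∀ x, x < a → ContDiffAt ℝ ∞ (heaviside a) x := fun x h =>
    contDiffAt_const.congr_of_eventuallyEq (heaviside_eventually_of_gt h)
  have hne : ∀ x ∉ ({a} : Finset ℝ), ContDiffAt ℝ ∞ (heaviside a) x := fun x hx => by
    rcases lt_or_gt_of_ne (Finset.notMem_singleton.1 hx) with h | h
    · exact hgt x h
    · exact hlt x h
  refine ⟨hne, fun x => ?_⟩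
  by_cases hx : x ∈ ({a} : Finset ℝ)
  · rw [Finset.mem_singleton] at hx
    subst hx
    refine ⟨(HasJets.of_contDiff (contDiff_const (c := (0 : ℝ))) x nhdsWithin_le_nhds).congr ?_,
      (HasJets.of_contDiff (contDiff_const (c := (1 : ℝ))) x nhdsWithin_le_nhds).congr ?_⟩
    · filter_upwards [self_mem_nhdsWithin] with y hy using (heaviside_eventually_of_gt hy).symm
    · filter_upwards [self_mem_nhdsWithin] with y hy using (heaviside_eventually_of_lt hy).symm
  · have := (eventually_notMem hx).mono hne
    exact ⟨.of_eventually this nhdsWithin_le_nhds, .of_eventually this nhdsWithin_le_nhds⟩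

theorem piecewiseSmooth_heaviside (a : ℝ) : PiecewiseSmooth (heaviside a) :=
  (smoothOff_heaviside a).piecewiseSmooth

theorem tendsto_heaviside_left (a x : ℝ) :
    Tendsto (heaviside a) (𝓝[<] x) (𝓝 (if a < x then 1 else 0)) := by
  split_ifs with h
  · exact (tendsto_const_nhds.congr' (heaviside_eventually_of_lt h).symm).mono_left
      nhdsWithin_le_nhds
  · refine tendsto_const_nhds.congr' ?_
    filter_upwards [self_mem_nhdsWithin] with y hy
    exact (heaviside_of_le ((le_of_lt hy).trans (not_lt.1 h))).symm

theorem tendsto_heaviside_right (a x : ℝ) :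
    Tendsto (heaviside a) (𝓝[>] x) (𝓝 (if a ≤ x then 1 else 0)) := by
  split_ifs with h
  · refine tendsto_const_nhds.congr' ?_
    filter_upwards [self_mem_nhdsWithin] with y hy
    exact (heaviside_of_lt (h.trans_lt hy)).symm
  · exact (tendsto_const_nhds.congr' (heaviside_eventually_of_gt (not_le.1 h)).symm).mono_left
      nhdsWithin_le_nhds

theorem deriv_heaviside {a x : ℝ} (h : x ≠ a) : deriv (heaviside a) x = 0 := by
  rcases lt_or_gt_of_ne h with h | h
  · rw [(heaviside_eventually_of_gt h).deriv_eq, deriv_const]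
  · rw [(heaviside_eventually_of_lt h).deriv_eq, deriv_const]

/-- A piecewise smooth function is the sum of a continuous one and of step functions. -/
theorem SmoothOff.exists_continuous_add {I : Finset ℝ} {f : ℝ → ℝ} (hf : SmoothOff I f) :
    ∃ r, Continuous r ∧ SmoothOff I r ∧ ∀ x ∉ I,
      f x = r x + ∑ a ∈ I, jump f a * heaviside a x ∧ deriv f x = deriv r x := by
  set S : ℝ → ℝ := fun x => ∑ a ∈ I, jump f a * heaviside a x with hS
  set g : ℝ → ℝ := fun x => f x + (-1) * S x with hg
  have hSs : SmoothOff I S := SmoothOff.sum I fun a ha =>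
    ((smoothOff_heaviside a).mono (Finset.singleton_subset_iff.2 ha)).const_mul _
  have hgs : SmoothOff I g := hf.add (hSs.const_mul _)
  have hfp := hf.piecewiseSmooth
  have hdense : Dense ((I : Set ℝ)ᶜ) := I.countable_toSet.dense_compl ℝ
  -- Subtracting the steps cancels each jump, so the two lateral limits of g agree on I and g
  -- extends continuously.
  have hlim : ∀ x, ∃ y, Tendsto g (𝓝[(I : Set ℝ)ᶜ] x) (𝓝 y) := by
    intro x
    by_cases hx : x ∈ I
    · refine ⟨leftVal f x + (-1) * ∑ a ∈ I, jump f a * (if a < x then 1 else 0), ?_⟩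
      have hle : 𝓝[(I : Set ℝ)ᶜ] x ≤ 𝓝[≠] x := nhdsWithin_mono x fun y hy hyx => by
        rw [mem_singleton_iff] at hyx
        exact hy (hyx ▸ hx)
      refine Tendsto.mono_left ?_ hle
      rw [← nhdsLT_sup_nhdsGT, tendsto_sup]
      refine ⟨(hfp.tendsto_left x).add ((tendsto_finsetSum _ fun a _ =>
        (tendsto_heaviside_left a x).const_mul _).const_mul _), ?_⟩
      have h2 := (hfp.tendsto_right x).add ((tendsto_finsetSum I fun a _ =>
        (tendsto_heaviside_right a x).const_mul (jump f a)).const_mul (-1))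
      refine h2.trans (le_of_eq ?_)
      congr 1
      -- The right and left limits of the step sum differ only in the term a = x, which contributes
      -- exactly the jump of f at x.
      have h3 : ∀ a, jump f a * (if a ≤ x then (1 : ℝ) else 0) =
          jump f a * (if a < x then 1 else 0) + if a = x then jump f a else 0 := by
        intro a
        rcases lt_trichotomy a x with h | h | h
        · simp [h, h.le, h.ne]
        · simp [h]
        · simp [h.not_ge, h.not_gt, h.ne']
      simp_rw [h3, Finset.sum_add_distrib, Finset.sum_ite_eq' I x, if_pos hx, jump]
      ring
    · exact ⟨g x, (hgs.1 x hx).continuousAt.continuousWithinAt⟩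
  have hr : ∀ x ∉ I, extendFrom (I : Set ℝ)ᶜ g x = g x := fun x hx =>
    extendFrom_eq (hdense x) (hgs.1 x hx).continuousAt.continuousWithinAt
  refine ⟨extendFrom (I : Set ℝ)ᶜ g, continuous_extendFrom hdense hlim,
    hgs.congr fun x hx => (hr x hx).symm, fun x hx => ⟨?_, ?_⟩⟩
  · rw [hr x hx, hg]
    ring
  · have h1 : extendFrom (I : Set ℝ)ᶜ g =ᶠ[𝓝 x] g := (eventually_notMem hx).mono hr
    have h2 : HasDerivAt S 0 x := by
      have : HasDerivAt S (∑ a ∈ I, jump f a * 0) x := by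
        refine HasDerivAt.fun_sum fun a ha => HasDerivAt.const_mul _ ?_
        have hax : x ∉ ({a} : Finset ℝ) := fun h => hx (Finset.mem_singleton.1 h ▸ ha)
        rw [← deriv_heaviside (a := a) (x := x) (fun h => hax (Finset.mem_singleton.2 h))]
        exact (((smoothOff_heaviside a).1 x hax).differentiableAt (by simp)).hasDerivAt
      simpa using this
    have h3 := ((hf.1 x hx).differentiableAt (by simp)).hasDerivAt.add (h2.const_mul (-1))
    have h4 : deriv g x = deriv f x + (-1) * 0 := HasDerivAt.deriv h3
    rw [h1.deriv_eq, h4]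
    ring

theorem PiecewiseSmooth.exists_primitive {f : ℝ → ℝ} (hf : PiecewiseSmooth f) :
    ∃ (I : Finset ℝ) (g : ℝ → ℝ), Continuous g ∧ SmoothOff I g ∧ ∀ x ∉ I, deriv g x = f x := by
  obtain ⟨I, h⟩ := piecewiseSmooth_iff.1 hf
  have hint : ∀ a b, IntervalIntegrable f volume a b := fun a b =>
    (hf.locallyIntegrable.locallyIntegrableOn _).integrableOn_isCompact isCompact_uIcc
      |>.intervalIntegrable
  set g : ℝ → ℝ := fun x => ∫ u in (0 : ℝ)..x, f u with hg
  have hgc : Continuous g := intervalIntegral.continuous_primitive hint 0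
  have hd : ∀ x ∉ I, HasDerivAt g (f x) x := fun x hx =>
    intervalIntegral.integral_hasDerivAt_right (hint 0 x)
      ⟨univ, univ_mem, h.aestronglyMeasurable.restrict⟩ (h.1 x hx).continuousAt
  have hde : ∀ x ∉ I, f =ᶠ[𝓝 x] deriv g := fun x hx =>
    (eventually_notMem hx).mono fun y hy => (hd y hy).deriv.symm
  have hs : ∀ x ∉ I, ContDiffAt ℝ ∞ g x := by
    have : ContDiffOn ℝ ∞ g (I : Set ℝ)ᶜ :=
      (contDiffOn_infty_iff_deriv_of_isOpen (isOpen_compl_finset I)).2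
        ⟨fun x hx => (hd x hx).differentiableAt.differentiableWithinAt, fun x hx =>
          ((h.1 x hx).congr_of_eventuallyEq (hde x hx).symm).contDiffWithinAt⟩
    exact fun x hx => this.contDiffAt ((isOpen_compl_finset I).mem_nhds hx)
  have hj : ∀ (l : Filter ℝ) (x : ℝ), l ≤ 𝓝 x → (∀ᶠ y in l, y ∉ I) → HasJets f l →
      HasJets g l := fun l x hl hI hfl => by
    -- Order zero is continuity of the primitive; the higher derivatives near l are those of f.
    refine ⟨hI.mono hs, fun n => ?_⟩
    cases n with
    | zero => exact ⟨g x, by simpa using (hgc.tendsto x).mono_left hl⟩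
    | succ n =>
      rw [iteratedDeriv_succ']
      exact (hfl.congr (hI.mono hde)).2 n
  exact ⟨I, g, hgc, ⟨hs, fun x => ⟨hj _ x nhdsWithin_le_nhds (eventually_lt_notMem I x) (h.2 x).1,
    hj _ x nhdsWithin_le_nhds (eventually_gt_notMem I x) (h.2 x).2⟩⟩, fun x hx => (hd x hx).deriv⟩

/-! ### Regular distributions -/

theorem reg_apply {f : ℝ → ℝ} (hf : LocallyIntegrable f volume) (t : TestFn ⊤) :
    reg f t = ∫ x, t x * f x := regOn_apply ⊤ (hf.locallyIntegrableOn _) t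

theorem integrable_test_mul {f : ℝ → ℝ} (hf : LocallyIntegrable f volume) (t : TestFn ⊤) :
    Integrable (fun x => t x * f x) volume :=
  TestFunction.integrable_bilin (ContinuousLinearMap.mul ℝ ℝ)
    (hf.locallyIntegrableOn ((⊤ : Opens ℝ) : Set ℝ)) t

theorem reg_congr {f g : ℝ → ℝ} (hf : LocallyIntegrable f volume)
    (hg : LocallyIntegrable g volume) (h : f =ᵐ[volume] g) : reg f = reg g := by
  refine Distr.ext fun t => ?_
  rw [reg_apply hf, reg_apply hg]
  refine integral_congr_ae ?_
  filter_upwards [h] with x hx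
  rw [hx]

theorem SmoothOff.reg_congr {I : Finset ℝ} {f g : ℝ → ℝ} (hf : PiecewiseSmooth f)
    (hg : PiecewiseSmooth g) (h : ∀ x ∉ I, f x = g x) : reg f = reg g :=
  DistrAlg.reg_congr hf.locallyIntegrable hg.locallyIntegrable <| by
    filter_upwards [compl_mem_ae_iff.2 (I.finite_toSet.measure_zero volume)] with x hx using h x hx

theorem reg_add {f g : ℝ → ℝ} (hf : LocallyIntegrable f volume)
    (hg : LocallyIntegrable g volume) : reg (fun x => f x + g x) = reg f + reg g := by
  refine Distr.ext fun t => ?_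
  rw [Distr.add_apply, reg_apply hf, reg_apply hg, show reg (fun x => f x + g x) t = ∫ x, t x * (f x + g x) from reg_apply (hf.add hg) t,
    ← integral_add (integrable_test_mul hf t) (integrable_test_mul hg t)]
  simp_rw [mul_add]

theorem reg_const_mul {f : ℝ → ℝ} (c : ℝ) (hf : LocallyIntegrable f volume) :
    reg (fun x => c * f x) = c • reg f := by
  refine Distr.ext fun t => ?_
  rw [Distr.smul_apply, reg_apply hf, show reg (fun x => c * f x) t = ∫ x, t x * (c * f x) from reg_apply (hf.smul c) t,
    ← integral_const_mul]
  congr 1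
  ext x
  ring

theorem smoothMul_reg {φ f : ℝ → ℝ} (hφ : ContDiff ℝ ∞ φ) (hf : PiecewiseSmooth f) :
    smoothMul hφ (reg f) = reg fun x => φ x * f x := by
  refine Distr.ext fun t => ?_
  rw [smoothMul_apply', reg_apply hf.locallyIntegrable,
    reg_apply (hφ.piecewiseSmooth.mul hf).locallyIntegrable]
  congr 1
  ext x
  rw [mulT_apply]
  ring

/-- Integration by parts: r t is continuous and differentiable off a finite set, so the fundamental
theorem with countably many exceptions applies and no boundary term arises at I. -/
theorem D_reg_of_continuous {r : ℝ → ℝ} {I : Finset ℝ} (hr : Continuous r)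
    (hd : SmoothOff I r) : D (reg r) = reg (deriv r) := by
  have hl := hd.deriv.piecewiseSmooth.locallyIntegrable
  refine Distr.ext fun t => ?_
  rw [D_apply_derivTest, reg_apply hr.locallyIntegrable, reg_apply hl, neg_eq_iff_add_eq_zero,
    ← integral_add (integrable_test_mul hr.locallyIntegrable _) (integrable_test_mul hl t)]
  obtain ⟨A, hA⟩ := t.hasCompactSupport.isCompact.isBounded.subset_ball 0
  rw [Real.ball_eq_Ioo, zero_sub, zero_add] at hA
  have ht0 : ∀ x, x ∉ Ioo (-A) A → t x = 0 := fun x hx => by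
    by_contra h
    exact hx (hA (subset_tsupport _ h))
  have hdt0 : ∀ x, x ∉ Ioo (-A) A → deriv t x = 0 := fun x hx => by
    by_contra h
    exact hx (hA (support_deriv_subset h))
  rw [← intervalIntegral.integral_eq_integral_of_support_subset (a := -A) (b := A) ?_,
    integral_eq_of_hasDerivAt_off_countable (fun x => r x * t x) _ I.countable_toSet
      (hr.mul t.continuous).continuousOn ?_ ?_, ht0 A (by simp), ht0 (-A) (by simp)]
  · ring
  · intro x hx
    have h1 := ((hd.1 x hx.2).differentiableAt (by simp)).hasDerivAt.mul
      (TestFn.differentiable t x).hasDerivAt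
    refine h1.congr_deriv ?_
    rw [derivTest_apply]
    ring
  · exact ((integrable_test_mul hr.locallyIntegrable _).add
      (integrable_test_mul hl t)).intervalIntegrable
  · intro x hx
    by_contra h
    have h' : x ∉ Ioo (-A) A := fun hx' => h (Ioo_subset_Ioc_self hx')
    rw [Function.mem_support, derivTest_apply, ht0 x h', hdt0 x h'] at hx
    simp at hx

theorem D_reg_heaviside (a : ℝ) : D (reg (heaviside a)) = dirac a := by
  refine Distr.ext fun t => ?_
  rw [D_apply_derivTest, reg_apply (piecewiseSmooth_heaviside a).locallyIntegrable,
    Distribution.delta_apply]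
  have h1 : (fun x => derivTest t x * heaviside a x) = (Ioi a).indicator (deriv t) := by
    ext x
    by_cases hx : a < x
    · simp [heaviside_of_lt hx, hx]
    · simp [heaviside_of_le (not_lt.1 hx), hx]
  rw [h1, integral_indicator measurableSet_Ioi, HasCompactSupport.integral_Ioi_deriv_eq
    (t.contDiff.of_le (by exact_mod_cast le_top)) t.hasCompactSupport, neg_neg]

theorem PiecewiseSmooth.sum {ι : Type*} (s : Finset ι) {f : ι → ℝ → ℝ}
    (hf : ∀ i, PiecewiseSmooth (f i)) : PiecewiseSmooth fun x => ∑ i ∈ s, f i x := by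
  classical
  induction s using Finset.induction_on with
  | empty => simpa using contDiff_const.piecewiseSmooth
  | insert a s ha ih =>
    simp_rw [Finset.sum_insert ha]
    exact (hf a).add ih

theorem reg_sum {ι : Type*} (s : Finset ι) (c : ι → ℝ) {f : ι → ℝ → ℝ}
    (hf : ∀ i, PiecewiseSmooth (f i)) :
    reg (fun x => ∑ i ∈ s, c i * f i x) = ∑ i ∈ s, c i • reg (f i) := by
  classical
  induction s using Finset.induction_on with
  | empty =>
    simp only [Finset.sum_empty]
    refine Distr.ext fun t => ?_
    rw [reg_apply (locallyIntegrable_const 0)]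
    simp
  | insert a s ha ih =>
    simp_rw [Finset.sum_insert ha]
    rw [reg_add ((hf a).const_mul _).locallyIntegrable
      (PiecewiseSmooth.sum s fun i => (hf i).const_mul (c i)).locallyIntegrable, ih,
      reg_const_mul _ (hf a).locallyIntegrable]

/-- The continuous part of a piecewise smooth function, and the derivative of the function. -/
theorem SmoothOff.exists_reg_eq {I : Finset ℝ} {f : ℝ → ℝ} (hf : SmoothOff I f) :
    ∃ r, Continuous r ∧ SmoothOff I r ∧
      (∀ x ∉ I, f x = r x + ∑ a ∈ I, jump f a * heaviside a x) ∧
      D (reg r) = reg (deriv f) ∧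
      reg f = reg r + ∑ a ∈ I, jump f a • reg (heaviside a) := by
  obtain ⟨r, hr, hs, h⟩ := hf.exists_continuous_add
  have h1 := PiecewiseSmooth.sum I fun a => (piecewiseSmooth_heaviside a).const_mul (jump f a)
  refine ⟨r, hr, hs, fun x hx => (h x hx).1, ?_, ?_⟩
  · rw [D_reg_of_continuous hr hs]
    exact SmoothOff.reg_congr hs.deriv.piecewiseSmooth hf.deriv.piecewiseSmooth fun x hx =>
      (h x hx).2.symm
  · rw [← reg_sum I (jump f) piecewiseSmooth_heaviside, ← reg_add hr.locallyIntegrable h1.locallyIntegrable]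
    exact SmoothOff.reg_congr hf.piecewiseSmooth (hs.piecewiseSmooth.add h1) fun x hx => (h x hx).1

/-- The jump formula: only the step part of f produces Dirac measures. -/
theorem SmoothOff.D_reg {I : Finset ℝ} {f : ℝ → ℝ} (hf : SmoothOff I f) :
    D (reg f) = reg (deriv f) + ∑ a ∈ I, jump f a • dirac a := by
  obtain ⟨r, -, -, -, h1, h2⟩ := hf.exists_reg_eq
  rw [h2, map_add, h1, map_sum]
  simp_rw [map_smul, D_reg_heaviside]

theorem PiecewiseSmooth.exists_D_eq {f : ℝ → ℝ} (hf : PiecewiseSmooth f) :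
    ∃ g, PiecewiseSmooth g ∧ D (reg g) = reg f := by
  obtain ⟨I, g, hg, hs, h⟩ := hf.exists_primitive
  refine ⟨g, hs.piecewiseSmooth, ?_⟩
  rw [D_reg_of_continuous hg hs]
  exact SmoothOff.reg_congr hs.deriv.piecewiseSmooth hf h

/-! ### Approximation by smooth functions -/

theorem contDiff_iteratedDeriv {h : ℝ → ℝ} (hh : ContDiff ℝ ∞ h) (k : ℕ) :
    ContDiff ℝ ∞ (iteratedDeriv k h) := by
  induction k generalizing h with
  | zero => simpa using hh
  | succ k ih =>
    rw [iteratedDeriv_succ']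
    exact ih (contDiff_deriv hh)

theorem D_iterate_reg_of_contDiff {h : ℝ → ℝ} (hh : ContDiff ℝ ∞ h) (k : ℕ) :
    (D^[k]) (reg h) = reg (iteratedDeriv k h) := by
  induction k generalizing h with
  | zero => simp
  | succ k ih =>
    rw [Function.iterate_succ_apply, D_reg_of_continuous hh.continuous (.of_contDiff hh ∅),
      ih (contDiff_deriv hh), iteratedDeriv_succ']

theorem D_iterate_apply (F : Distr) (k : ℕ) (t : TestFn ⊤) :
    (D^[k]) F t = (-1) ^ k * F (derivTest^[k] t) := by
  induction k generalizing t with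
  | zero => simp
  | succ k ih =>
    rw [Function.iterate_succ_apply', D_apply_derivTest, ih, ← Function.iterate_succ_apply]
    ring

theorem tendsto_D_iterate {ι : Type} {l : Filter ι} {u : ι → Distr} {F : Distr}
    (h : TendstoDistr u l F) (k : ℕ) : TendstoDistr (fun i => (D^[k]) (u i)) l ((D^[k]) F) := by
  intro t
  simp_rw [D_iterate_apply]
  exact (h _).const_mul _

theorem tendstoDistr_reg_of_dist_lt {h : ℕ → ℝ → ℝ} {g : ℝ → ℝ} (hg : Continuous g)
    (hh : ∀ n, Continuous (h n)) (hd : ∀ n x, dist (h n x) (g x) < 1 / ((n : ℝ) + 1)) :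
    TendstoDistr (fun n => reg (h n)) atTop (reg g) := by
  intro t
  refine tendsto_iff_dist_tendsto_zero.2 (squeeze_zero (fun _ => dist_nonneg) (fun n => ?_)
    (by simpa using (tendsto_one_div_add_atTop_nhds_zero_nat (𝕜 := ℝ)).const_mul (∫ x, ‖t x‖)))
  have hint : Integrable (fun x => ‖t x‖) volume :=
    (t.continuous.integrable_of_hasCompactSupport t.hasCompactSupport).norm
  rw [reg_apply (hh n).locallyIntegrable, reg_apply hg.locallyIntegrable, dist_eq_norm,
    ← integral_sub (integrable_test_mul (hh n).locallyIntegrable t)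
      (integrable_test_mul hg.locallyIntegrable t), ← integral_mul_const]
  refine norm_integral_le_of_norm_le (hint.mul_const _) (Eventually.of_forall fun x => ?_)
  rw [← mul_sub, norm_mul]
  exact mul_le_mul_of_nonneg_left (by simpa [dist_eq_norm] using (hd n x).le) (norm_nonneg _)

theorem exists_contDiff_tendsto {g : ℝ → ℝ} (hg : Continuous g) :
    ∃ h : ℕ → ℝ → ℝ, (∀ n, ContDiff ℝ ∞ (h n)) ∧
      TendstoDistr (fun n => reg (h n)) atTop (reg g) := by
  have : ∀ n : ℕ, ∃ h : ℝ → ℝ, ContDiff ℝ ∞ h ∧ ∀ x, dist (h x) (g x) < 1 / ((n : ℝ) + 1) := by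
    intro n
    obtain ⟨h, h1, -⟩ := hg.exists_contMDiff_approx (modelWithCornersSelf ℝ ℝ) ⊤
      (ε := fun _ => 1 / ((n : ℝ) + 1)) continuous_const (fun _ => by positivity)
    exact ⟨h, h.contMDiff.contDiff, h1⟩
  choose h hs hd using this
  exact ⟨h, hs, tendstoDistr_reg_of_dist_lt hg (fun n => (hs n).continuous) hd⟩

/-- A distribution which is locally a derivative of finite order of continuous functions is the
limit of a sequence of smooth functions. -/
theorem exists_contDiff_tendsto_of_locally {F : Distr}
    (hF : ∀ x : ℝ, ∃ (Ω : Opens ℝ) (k : ℕ) (g : ℝ → ℝ), x ∈ Ω ∧ Continuous g ∧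
      restrict Ω F = restrict Ω ((D^[k]) (reg g))) :
    ∃ u : ℕ → ℝ → ℝ, (∀ n, ContDiff ℝ ∞ (u n)) ∧
      TendstoDistr (fun n => reg (u n)) atTop F := by
  choose Ω k g hΩ hg hF using hF
  obtain ⟨χ, hχ, hs⟩ := exists_partition Ω hΩ
  choose h hsm hlim using fun i => exists_contDiff_tendsto (hg i)
  have hder : ∀ i n, ContDiff ℝ ∞ (iteratedDeriv (k i) (h i n)) := fun i n =>
    contDiff_iteratedDeriv (hsm i n) (k i)
  -- The approximants glue the local derivatives of smooth approximations of `g i`. For a fixed test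
  -- function only the finitely many indices in `s` matter, so the limit passes through the sum.
  have hu : ∀ n, ContDiff ℝ ∞ fun y => ∑ᶠ i, χ i y • iteratedDeriv (k i) (h i n) y := fun n =>
    (χ.contMDiff_finsum_smul (n := ⊤) fun i x _ =>
      (hder i n).contMDiff.contMDiffAt).contDiff
  refine ⟨_, hu, fun t => ?_⟩
  obtain ⟨s, h0, ht⟩ := hs t
  have hFt : F t = ∑ i ∈ s, (D^[k i]) (reg (g i)) (mulT (χ i).contMDiff.contDiff t) := by
    conv_lhs => rw [ht, map_sum]
    exact Finset.sum_congr rfl fun i _ =>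
      restrict_eq_restrict_iff.1 (hF i) _ (tsupport_mulT_subset _ _ (hχ i))
  have hut : ∀ n, reg (fun y => ∑ᶠ i, χ i y • iteratedDeriv (k i) (h i n) y) t =
      ∑ i ∈ s, (D^[k i]) (reg (h i n)) (mulT (χ i).contMDiff.contDiff t) := by
    intro n
    have h1 : ∀ i, LocallyIntegrable (iteratedDeriv (k i) (h i n)) volume := fun i =>
      (hder i n).continuous.locallyIntegrable
    simp_rw [D_iterate_reg_of_contDiff (hsm _ n), reg_apply (h1 _)]
    rw [reg_apply (hu n).continuous.locallyIntegrable,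
      ← integral_finsetSum s fun i _ => integrable_test_mul (h1 i) _]
    congr 1
    ext y
    have hsub : (Function.support fun i => χ i y • iteratedDeriv (k i) (h i n) y * t y) ⊆ s := by
      intro i hi
      by_contra hne
      refine hi ?_
      change χ i y * iteratedDeriv (k i) (h i n) y * t y = 0
      rw [mul_right_comm, h0 i hne y, zero_mul]
    have hfin : (Function.support fun i => χ i y • iteratedDeriv (k i) (h i n) y).Finite :=
      (χ.locallyFinite.point_finite y).subset fun i hi => left_ne_zero_of_mul hi
    rw [mul_comm, finsum_mul' _ _ hfin, finsum_eq_sum_of_support_subset _ hsub]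
    refine Finset.sum_congr rfl fun i _ => ?_
    rw [mulT_apply, smul_eq_mul]
    ring
  rw [hFt]
  simp_rw [hut]
  exact tendsto_finsetSum _ fun i _ => tendsto_D_iterate (hlim i) (k i) _

/-- In an algebra of distributions, the product by a smooth function is the dual product. -/
theorem IsDistrAlgebra.smooth_mul {G : Submodule ℝ Distr} {mul : G →ₗ[ℝ] G →ₗ[ℝ] G}
    (hG : IsDistrAlgebra G mul) (hloc : LocallyDerivOfContinuous G)
    (hcont : PartiallyContinuousAt mul 0) {ξ : ℝ → ℝ} (hξ : ContDiff ℝ ∞ ξ) (X F : G)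
    (hX : (X : Distr) = reg ξ) :
    (mul X F : Distr) = smoothMul hξ F ∧ (mul F X : Distr) = smoothMul hξ F := by
  obtain ⟨u, hu, hlim⟩ := exists_contDiff_tendsto_of_locally (F := F) fun x => by
    obtain ⟨Ω, k, g, h1, h2, -, h3⟩ := hloc F F.2 x
    exact ⟨Ω, k, g, h1, h2, h3⟩
  let U : ℕ → G := fun n => ⟨reg (u n), hG.piecewiseSmooth_mem _ (hu n).piecewiseSmooth⟩
  have hXU : ∀ n, (mul X (U n) : Distr) = smoothMul hξ (reg (u n)) := fun n => by
    rw [hG.mul_continuous ξ (u n) hξ.continuous (hu n).continuous X (U n) hX rfl,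
      smoothMul_reg hξ (hu n).piecewiseSmooth]
  have hUX : ∀ n, (mul (U n) X : Distr) = smoothMul hξ (reg (u n)) := fun n => by
    rw [hG.mul_continuous (u n) ξ (hu n).continuous hξ.continuous (U n) X rfl hX,
      smoothMul_reg hξ (hu n).piecewiseSmooth]
    simp_rw [mul_comm]
  -- Bilinearity reduces continuity along U n → F to continuity at zero.
  have h0 : TendstoDistr (fun n => ((F - U n : G) : Distr)) atTop ((0 : G) : Distr) := fun t => by
    have := (tendsto_const_nhds (x := (F : Distr) t)).sub (hlim t)
    rw [sub_self] at this
    exact this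
  obtain ⟨h1, h2⟩ := hcont ξ hξ X hX _ h0
  constructor
  · refine Distr.ext fun t => ?_
    have h3 := h1 t
    simp only [map_sub, map_zero, Submodule.coe_sub, hXU, Distr.sub_apply] at h3
    -- Adding back ⟨u n, ξ t⟩ leaves a constant sequence, whose value is identified with the limit
    -- ⟨F, ξ t⟩.
    have h4 := h3.add (hlim (mulT hξ t))
    simp only [smoothMul_apply', sub_add_cancel] at h4
    have h5 := tendsto_nhds_unique tendsto_const_nhds h4
    rw [h5, smoothMul_apply', Submodule.coe_zero, Distr.zero_apply, zero_add]
  · refine Distr.ext fun t => ?_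
    have h3 := h2 t
    simp only [map_sub, map_zero, LinearMap.sub_apply, LinearMap.zero_apply, Submodule.coe_sub,
      hUX, Distr.sub_apply] at h3
    have h4 := h3.add (hlim (mulT hξ t))
    simp only [smoothMul_apply', sub_add_cancel] at h4
    have h5 := tendsto_nhds_unique tendsto_const_nhds h4
    rw [h5, smoothMul_apply', Submodule.coe_zero, Distr.zero_apply, zero_add]

/-! ### Products in an algebra of distributions -/

/-- An associative differential algebra of distributions which contains the piecewise smooth
functions, and in which products by smooth functions are dual products. -/
structure DerivAlgebra (G : Submodule ℝ Distr) (mul : G →ₗ[ℝ] G →ₗ[ℝ] G) (d : G →ₗ[ℝ] G) :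
    Prop where
  assoc : ∀ F H J : G, mul (mul F H) J = mul F (mul H J)
  reg_mem : ∀ f : ℝ → ℝ, PiecewiseSmooth f → reg f ∈ G
  leibniz : ∀ F H : G, d (mul F H) = mul (d F) H + mul F (d H)
  coe_d : ∀ F : G, (d F : Distr) = D F
  mul_continuous : ∀ f h : ℝ → ℝ, Continuous f → Continuous h → ∀ F H : G,
    (F : Distr) = reg f → (H : Distr) = reg h → (mul F H : Distr) = reg (fun x => f x * h x)
  smooth_left : ∀ (ξ : ℝ → ℝ) (hξ : ContDiff ℝ ∞ ξ) (X F : G), (X : Distr) = reg ξ →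
    (mul X F : Distr) = smoothMul hξ F
  smooth_right : ∀ (ξ : ℝ → ℝ) (hξ : ContDiff ℝ ∞ ξ) (X F : G), (X : Distr) = reg ξ →
    (mul F X : Distr) = smoothMul hξ F

namespace DerivAlgebra

variable {G : Submodule ℝ Distr} {mul : G →ₗ[ℝ] G →ₗ[ℝ] G} {d : G →ₗ[ℝ] G}

/-- The opposite algebra. -/
theorem flip (A : DerivAlgebra G mul d) : DerivAlgebra G mul.flip d where
  assoc F H J := (A.assoc J H F).symm
  reg_mem := A.reg_mem
  leibniz F H := (A.leibniz H F).trans (add_comm _ _)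
  coe_d := A.coe_d
  mul_continuous f h hf hh F H hF hH := by
    rw [LinearMap.flip_apply, A.mul_continuous h f hh hf H F hH hF]
    simp_rw [mul_comm]
  smooth_left := A.smooth_right
  smooth_right := A.smooth_left

/-- The element of the algebra given by a piecewise smooth function. -/
def fn (A : DerivAlgebra G mul d) (f : ℝ → ℝ) (hf : PiecewiseSmooth f) : G :=
  ⟨reg f, A.reg_mem f hf⟩

/-- The Heaviside function with jump at `a`. -/
def step (A : DerivAlgebra G mul d) (a : ℝ) : G := A.fn (heaviside a) (piecewiseSmooth_heaviside a)

/-- The `j`-th derivative of the Dirac measure at `a`. -/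
def delta (A : DerivAlgebra G mul d) (a : ℝ) (j : ℕ) : G := d^[j] (d (A.step a))

variable (A : DerivAlgebra G mul d)

theorem coe_fn (f : ℝ → ℝ) (hf : PiecewiseSmooth f) : (A.fn f hf : Distr) = reg f := rfl

theorem coe_step (a : ℝ) : (A.step a : Distr) = reg (heaviside a) := rfl

theorem coe_d_iterate (A : DerivAlgebra G mul d) (j : ℕ) (F : G) : ((d^[j] F : G) : Distr) = (D^[j]) F := by
  induction j with
  | zero => rfl
  | succ j ih => rw [Function.iterate_succ_apply', A.coe_d, ih, Function.iterate_succ_apply']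

theorem coe_delta (a : ℝ) (j : ℕ) : (A.delta a j : Distr) = (D^[j]) (dirac a) := by
  rw [delta, A.coe_d_iterate, A.coe_d, coe_step, D_reg_heaviside]

theorem d_delta (a : ℝ) (j : ℕ) : d (A.delta a j) = A.delta a (j + 1) :=
  (Function.iterate_succ_apply' d j _).symm

theorem d_step (a : ℝ) : d (A.step a) = A.delta a 0 := rfl

/-- The element of the algebra given by a smooth function. -/
def smooth {ξ : ℝ → ℝ} (hξ : ContDiff ℝ ∞ ξ) : G := A.fn ξ hξ.piecewiseSmooth

theorem coe_smooth_mul {ξ : ℝ → ℝ} (hξ : ContDiff ℝ ∞ ξ) (F : G) :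
    (mul (A.smooth hξ) F : Distr) = smoothMul hξ F := A.smooth_left ξ hξ _ F rfl

theorem smooth_mul_comm {ξ : ℝ → ℝ} (hξ : ContDiff ℝ ∞ ξ) (F : G) :
    mul (A.smooth hξ) F = mul F (A.smooth hξ) :=
  Subtype.ext ((A.coe_smooth_mul hξ F).trans (A.smooth_right ξ hξ _ F rfl).symm)

/-- Smooth factors are central, so by associativity they pass from one factor to the other. The
localization arguments below rest on this. -/
theorem mul_smooth_mul {ξ : ℝ → ℝ} (hξ : ContDiff ℝ ∞ ξ) (F H : G) :
    mul F (mul (A.smooth hξ) H) = mul (mul (A.smooth hξ) F) H := by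
  rw [← A.assoc, A.smooth_mul_comm]

theorem fn_congr {f g : ℝ → ℝ} (hf : PiecewiseSmooth f) (hg : PiecewiseSmooth g)
    (h : ∀ x, f x = g x) : A.fn f hf = A.fn g hg := by
  obtain rfl : f = g := funext h
  rfl

theorem smooth_mul_fn {ξ f : ℝ → ℝ} (hξ : ContDiff ℝ ∞ ξ) (hf : PiecewiseSmooth f) :
    mul (A.smooth hξ) (A.fn f hf) = A.fn _ (hξ.piecewiseSmooth.mul hf) :=
  Subtype.ext ((A.coe_smooth_mul hξ _).trans (smoothMul_reg hξ hf))

theorem d_sub_mul (a : ℝ) (F : G) : mul (d (A.smooth (contDiff_sub_const a))) F = F := by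
  have h1 : ((d (A.smooth (contDiff_sub_const a)) : G) : Distr) = reg fun _ => 1 := by
    rw [A.coe_d]
    refine (D_reg_of_continuous (I := ∅) (contDiff_sub_const a).continuous
      (.of_contDiff (contDiff_sub_const a) ∅)).trans ?_
    congr 1
    ext x
    simp
  refine Subtype.ext ((A.smooth_left _ contDiff_const _ F h1).trans (Distr.ext fun t => ?_))
  exact smoothMul_apply _ _ t t fun x => (one_mul _).symm

theorem sub_mul_delta_zero (a : ℝ) :
    mul (A.smooth (contDiff_sub_const a)) (A.delta a 0) = 0 := by
  refine Subtype.ext ?_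
  rw [A.coe_smooth_mul, A.coe_delta]
  change smoothMul (contDiff_sub_const a) (dirac a) = 0
  rw [smoothMul_dirac, sub_self, zero_smul]

/-- Differentiate (x - a) δ = 0. -/
theorem sub_mul_delta_one (a : ℝ) :
    mul (A.smooth (contDiff_sub_const a)) (A.delta a 1) = -A.delta a 0 := by
  have h := congrArg d (A.sub_mul_delta_zero a)
  rw [A.leibniz, A.d_sub_mul, A.d_delta, map_zero] at h
  exact eq_neg_of_add_eq_zero_right h

theorem exists_eq_smul_delta {F : G} {a : ℝ}
    (h : mul (A.smooth (contDiff_sub_const a)) F = 0) : ∃ c : ℝ, F = c • A.delta a 0 := by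
  obtain ⟨c, hc⟩ := exists_eq_smul_dirac (F := (F : Distr)) (a := a) (by
    rw [← A.coe_smooth_mul, h]
    rfl)
  exact ⟨c, Subtype.ext (by rw [hc, Submodule.coe_smul, A.coe_delta]; rfl)⟩

theorem delta_zero_ne_zero (a : ℝ) : A.delta a 0 ≠ 0 := fun h =>
  dirac_ne_zero a (by simpa [h] using (A.coe_delta a 0).symm)

/-- The positive part `(x - a)₊`. -/
def ramp (a : ℝ) : ℝ → ℝ := fun x => (x - a) * heaviside a x

theorem ramp_eq_max (a x : ℝ) : ramp a x = max (x - a) 0 := by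
  rcases lt_or_ge a x with h | h
  · rw [ramp, heaviside_of_lt h, max_eq_left (by linarith), mul_one]
  · rw [ramp, heaviside_of_le h, max_eq_right (by linarith), mul_zero]

theorem continuous_ramp (a : ℝ) : Continuous (ramp a) := by
  rw [funext (ramp_eq_max a)]
  fun_prop

theorem piecewiseSmooth_ramp (a : ℝ) : PiecewiseSmooth (ramp a) :=
  (contDiff_sub_const a).piecewiseSmooth.mul (piecewiseSmooth_heaviside a)

theorem sub_mul_step (a : ℝ) : mul (A.smooth (contDiff_sub_const a)) (A.step a) =
    A.fn (ramp a) (piecewiseSmooth_ramp a) :=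
  A.smooth_mul_fn (contDiff_sub_const a) (piecewiseSmooth_heaviside a)

theorem d_ramp (a : ℝ) : d (A.fn (ramp a) (piecewiseSmooth_ramp a)) = A.step a := by
  rw [← A.sub_mul_step, A.leibniz, A.d_sub_mul, A.d_step, A.sub_mul_delta_zero, add_zero]

/-- No axiom gives products of discontinuous functions directly. The square of the continuous ramp
is known; its derivative determines H H up to a multiple of δ, and a second differentiation removes
that multiple. -/
theorem step_mul_self (a : ℝ) : mul (A.step a) (A.step a) = A.step a := by
  set X := A.smooth (contDiff_sub_const a) with hX
  set R := A.fn (ramp a) (piecewiseSmooth_ramp a) with hR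
  set H := A.step a with hH
  have hXH : mul X H = R := A.sub_mul_step a
  have hdR : d R = H := A.d_ramp a
  have h1 : mul R R = mul X R := by
    refine Subtype.ext ?_
    rw [A.mul_continuous _ _ (continuous_ramp a) (continuous_ramp a) R R rfl rfl,
      hX, A.smooth_mul_fn, coe_fn]
    congr 1
    ext x
    rcases lt_or_ge a x with h | h
    · simp [ramp, heaviside_of_lt h]
    · simp [ramp, heaviside_of_le h]
  have h2 : d (mul R R) = R + R := by
    rw [h1, A.leibniz, A.d_sub_mul, hdR, hXH]
  -- Both H R and R H reduce to (x - a)(H H), so noncommutativity of ⊛ does no harm.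
  have h3 : mul H R = mul X (mul H H) := by
    rw [← hXH, A.mul_smooth_mul, A.assoc]
  have h4 : mul R H = mul X (mul H H) := by
    rw [← hXH, A.assoc]
  rw [A.leibniz, hdR, h3, h4, ← two_smul ℝ, ← two_smul ℝ] at h2
  have h5 : mul X (mul H H) = R := smul_right_injective G (two_ne_zero (α := ℝ)) h2
  obtain ⟨c, hc⟩ := A.exists_eq_smul_delta (F := mul H H - H) (a := a) (by
    rw [map_sub, ← hX, h5, hXH, sub_self])
  have h6 : mul X (mul (A.delta a 0) H) = 0 := by
    rw [← A.assoc, A.sub_mul_delta_zero, map_zero, LinearMap.zero_apply]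
  have h7 : mul X (mul H (A.delta a 0)) = 0 := by
    rw [← A.assoc, A.smooth_mul_comm, A.assoc, A.sub_mul_delta_zero, map_zero]
  -- Apply (x - a) d to H H = cδ + H. The left side vanishes by `h6` and `h7`; the right side is
  -- -cδ, since (x - a) δ' = -δ and (x - a) δ = 0.
  have h8 := congrArg (fun F => mul X (d F)) (sub_eq_iff_eq_add.1 hc)
  simp only [A.leibniz, map_add, map_smul, A.d_delta, hH, A.d_step] at h8
  rw [← hH, h6, h7, (A.sub_mul_delta_zero a : mul X _ = _),
    (A.sub_mul_delta_one a : mul X (A.delta a (0 + 1)) = _)] at h8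
  simp only [add_zero, smul_neg] at h8
  have h9 : c = 0 := (smul_eq_zero.1 (neg_eq_zero.1 h8.symm)).resolve_right (A.delta_zero_ne_zero a)
  rw [h9, zero_smul, sub_eq_zero] at hc
  exact hc

theorem delta_mul_step_add (a : ℝ) :
    mul (A.delta a 0) (A.step a) + mul (A.step a) (A.delta a 0) = A.delta a 0 := by
  rw [← A.d_step, ← A.leibniz, A.step_mul_self]

/-- H δ is killed by x - a, so it is κδ; idempotency of H gives κ² = κ. This is the only freedom in
the product on 𝓐. -/
theorem step_mul_delta_eq_or (a : ℝ) :
    mul (A.step a) (A.delta a 0) = 0 ∨ mul (A.step a) (A.delta a 0) = A.delta a 0 := by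
  obtain ⟨κ, hκ⟩ := A.exists_eq_smul_delta (F := mul (A.step a) (A.delta a 0)) (a := a) (by
    rw [← A.assoc, A.smooth_mul_comm, A.assoc, A.sub_mul_delta_zero, map_zero])
  have h : mul (A.step a) (mul (A.step a) (A.delta a 0)) = mul (A.step a) (A.delta a 0) := by
    rw [← A.assoc, A.step_mul_self]
  rw [hκ, map_smul, hκ, smul_smul] at h
  have h1 : κ * κ = κ := smul_left_injective ℝ (A.delta_zero_ne_zero a) h
  have h2 : κ * (κ - 1) = 0 := by rw [mul_sub, h1, mul_one, sub_self]
  rcases (mul_eq_zero.1 h2).imp_right sub_eq_zero.1 with h0 | h0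
  · exact Or.inl (by rw [hκ, h0, zero_smul])
  · exact Or.inr (by rw [hκ, h0, one_smul])

/-! ### Products at different points -/

theorem exists_cutoff {a b : ℝ} (hab : a < b) : ∃ ψ : ℝ → ℝ, ContDiff ℝ ∞ ψ ∧
    (∃ p, a < p ∧ ∀ x ≤ p, ψ x = 0) ∧ ∃ q, q < b ∧ ∀ x, q ≤ x → ψ x = 1 := by
  have h3 : (0 : ℝ) < (b - a) / 3 := by linarith
  -- The transition from 0 to 1 takes place in the middle third of [a, b].
  refine ⟨fun x => Real.smoothTransition ((x - (a + (b - a) / 3)) / ((b - a) / 3)),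
    Real.smoothTransition.contDiff.comp ((contDiff_sub_const _).div_const _),
    ⟨a + (b - a) / 3, by linarith, fun x hx => ?_⟩, ⟨b - (b - a) / 3, by linarith, fun x hx => ?_⟩⟩
  · exact Real.smoothTransition.zero_of_nonpos (div_nonpos_of_nonpos_of_nonneg (by linarith) h3.le)
  · exact Real.smoothTransition.one_of_one_le ((one_le_div h3).2 (by linarith))

/-- If `a < b`, the elements `step a` and `delta a j` are separated from `step b`, `delta b j` by a
smooth function. -/
theorem exists_separating {a b : ℝ} (hab : a < b) : ∃ (ψ : ℝ → ℝ) (hψ : ContDiff ℝ ∞ ψ),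
    mul (A.smooth hψ) (A.step a) = A.smooth hψ ∧ mul (A.smooth hψ) (A.step b) = A.step b ∧
    (∀ j, mul (A.smooth hψ) (A.delta a j) = 0) ∧
    ∀ j, mul (A.smooth hψ) (A.delta b j) = A.delta b j := by
  obtain ⟨ψ, hψ, ⟨p, hap, hp⟩, q, hqb, hq⟩ := exists_cutoff hab
  refine ⟨ψ, hψ, (A.smooth_mul_fn hψ _).trans (A.fn_congr _ _ fun x => ?_),
    (A.smooth_mul_fn hψ _).trans (A.fn_congr _ _ fun x => ?_), fun j => Subtype.ext ?_,
    fun j => Subtype.ext ?_⟩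
  · rcases lt_or_ge a x with h | h
    · rw [heaviside_of_lt h, mul_one]
    · rw [hp x (h.trans hap.le), zero_mul]
  · rcases lt_or_ge b x with h | h
    · rw [hq x (hqb.le.trans h.le), one_mul]
    · rw [heaviside_of_le h, mul_zero]
  · rw [A.coe_smooth_mul, A.coe_delta]
    exact smoothMul_D_iterate_dirac_of_eq_zero hψ a j (by
      filter_upwards [Iio_mem_nhds hap] with x hx using hp x (le_of_lt hx))
  · rw [A.coe_smooth_mul, A.coe_delta]
    exact smoothMul_D_iterate_dirac_of_eq_one hψ b j (by
      filter_upwards [Ioi_mem_nhds hqb] with x hx using hq x (le_of_lt hx))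

theorem step_mul_step_of_lt {a b : ℝ} (hab : a < b) : mul (A.step a) (A.step b) = A.step b := by
  obtain ⟨ψ, hψ, h1, h2, -, -⟩ := A.exists_separating hab
  rw [← h2, A.mul_smooth_mul, h1]

theorem step_mul_delta_of_lt {a b : ℝ} (hab : a < b) (j : ℕ) :
    mul (A.step a) (A.delta b j) = A.delta b j := by
  obtain ⟨ψ, hψ, h1, -, -, h4⟩ := A.exists_separating hab
  rw [← h4, A.mul_smooth_mul, h1]

theorem step_mul_delta_of_gt {a b : ℝ} (hab : a < b) (j : ℕ) :
    mul (A.step b) (A.delta a j) = 0 := by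
  obtain ⟨ψ, hψ, -, h2, h3, -⟩ := A.exists_separating hab
  rw [← h2, ← A.mul_smooth_mul, h3, map_zero]

theorem delta_mul_delta_of_lt {a b : ℝ} (hab : a < b) (i j : ℕ) :
    mul (A.delta a i) (A.delta b j) = 0 := by
  obtain ⟨ψ, hψ, -, -, h3, h4⟩ := A.exists_separating hab
  rw [← h4, A.mul_smooth_mul, h3, map_zero, LinearMap.zero_apply]

theorem delta_mul_delta_of_ne {a b : ℝ} (hab : a ≠ b) (i j : ℕ) :
    mul (A.delta a i) (A.delta b j) = 0 := by
  rcases lt_or_gt_of_ne hab with h | h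
  · exact A.delta_mul_delta_of_lt h i j
  · exact A.flip.delta_mul_delta_of_lt h j i

theorem step_mul_step (a b : ℝ) : mul (A.step a) (A.step b) =
    A.fn _ ((piecewiseSmooth_heaviside a).mul (piecewiseSmooth_heaviside b)) := by
  rcases lt_trichotomy a b with h | h | h
  · rw [A.step_mul_step_of_lt h]
    refine A.fn_congr _ _ fun x => ?_
    rcases lt_or_ge b x with h' | h'
    · rw [heaviside_of_lt (h.trans h'), one_mul]
    · rw [heaviside_of_le h', mul_zero]
  · subst h
    rw [A.step_mul_self]
    refine A.fn_congr _ _ fun x => ?_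
    rcases lt_or_ge a x with h' | h'
    · rw [heaviside_of_lt h', one_mul]
    · rw [heaviside_of_le h', mul_zero]
  · refine (A.flip.step_mul_step_of_lt h).trans ?_
    refine A.fn_congr (piecewiseSmooth_heaviside a) _ fun x => ?_
    rcases lt_or_ge a x with h' | h'
    · rw [heaviside_of_lt h', heaviside_of_lt (h.trans h'), one_mul]
    · rw [heaviside_of_le h', zero_mul]

end DerivAlgebra

namespace DerivAlgebra

variable {G : Submodule ℝ Distr} {mul : G →ₗ[ℝ] G →ₗ[ℝ] G} {d : G →ₗ[ℝ] G}
  (A : DerivAlgebra G mul d)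

/-! ### Products of piecewise smooth functions -/

theorem exists_fn_eq {I : Finset ℝ} {f : ℝ → ℝ} (hf : SmoothOff I f) :
    ∃ (r : ℝ → ℝ) (hr : SmoothOff I r), Continuous r ∧
      (∀ x ∉ I, f x = r x + ∑ a ∈ I, jump f a * heaviside a x) ∧
      A.fn f hf.piecewiseSmooth = A.fn r hr.piecewiseSmooth + ∑ a ∈ I, jump f a • A.step a := by
  obtain ⟨r, hc, hr, h1, -, h2⟩ := hf.exists_reg_eq
  refine ⟨r, hr, hc, h1, Subtype.ext ?_⟩
  rw [Submodule.coe_add, AddSubmonoidClass.coe_finsetSum, coe_fn, coe_fn, h2]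
  rfl

theorem d_fn {I : Finset ℝ} {f : ℝ → ℝ} (hf : SmoothOff I f) :
    d (A.fn f hf.piecewiseSmooth) =
      A.fn (deriv f) hf.deriv.piecewiseSmooth + ∑ a ∈ I, jump f a • A.delta a 0 := by
  refine Subtype.ext ?_
  rw [A.coe_d, Submodule.coe_add, AddSubmonoidClass.coe_finsetSum, coe_fn, coe_fn, hf.D_reg]
  simp_rw [Submodule.coe_smul, A.coe_delta]
  rfl

theorem d_fn_of_continuous {I : Finset ℝ} {r : ℝ → ℝ} (hc : Continuous r) (hr : SmoothOff I r) :
    d (A.fn r hr.piecewiseSmooth) = A.fn (deriv r) hr.deriv.piecewiseSmooth :=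
  Subtype.ext ((A.coe_d _).trans (D_reg_of_continuous hc hr))

theorem fn_congr_off {I : Finset ℝ} {f g : ℝ → ℝ} (hf : PiecewiseSmooth f)
    (hg : PiecewiseSmooth g) (h : ∀ x ∉ I, f x = g x) : A.fn f hf = A.fn g hg :=
  Subtype.ext (SmoothOff.reg_congr hf hg h)

theorem fn_add {f g : ℝ → ℝ} (hf : PiecewiseSmooth f) (hg : PiecewiseSmooth g) :
    A.fn _ (hf.add hg) = A.fn f hf + A.fn g hg :=
  Subtype.ext (reg_add hf.locallyIntegrable hg.locallyIntegrable)

theorem fn_const_mul {f : ℝ → ℝ} (c : ℝ) (hf : PiecewiseSmooth f) :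
    A.fn _ (hf.const_mul c) = c • A.fn f hf :=
  Subtype.ext (reg_const_mul c hf.locallyIntegrable)

/-- Products with `F` on the right are pointwise products with `h` if this is so for continuous
functions and for step functions on the left. -/
theorem fn_mul_of {h : ℝ → ℝ} (hh : PiecewiseSmooth h) (F : G)
    (h1 : ∀ (r : ℝ → ℝ) (hr : PiecewiseSmooth r), Continuous r →
      mul (A.fn r hr) F = A.fn _ (hr.mul hh))
    (h2 : ∀ a, mul (A.step a) F = A.fn _ ((piecewiseSmooth_heaviside a).mul hh))
    {f : ℝ → ℝ} (hf : PiecewiseSmooth f) : mul (A.fn f hf) F = A.fn _ (hf.mul hh) := by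
  obtain ⟨I, hI⟩ := piecewiseSmooth_iff.1 hf
  obtain ⟨r, hr, hc, hfr, hfn⟩ := A.exists_fn_eq hI
  have hs := fun a => (piecewiseSmooth_heaviside a).mul hh
  have hsum := PiecewiseSmooth.sum I fun a => (hs a).const_mul (jump f a)
  have hpt : ∀ x ∉ I, f x * h x = r x * h x + ∑ a ∈ I, jump f a * (heaviside a x * h x) :=
    fun x hx => by
      rw [hfr x hx, add_mul, Finset.sum_mul]
      simp_rw [mul_assoc]
  rw [hfn, map_add, LinearMap.add_apply, h1 r _ hc, map_sum, LinearMap.sum_apply]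
  simp_rw [map_smul, LinearMap.smul_apply, h2]
  rw [A.fn_congr_off (I := I) (hf.mul hh) ((hr.piecewiseSmooth.mul hh).add hsum) hpt,
    A.fn_add (hr.piecewiseSmooth.mul hh) hsum]
  congr 1
  refine Subtype.ext ?_
  rw [AddSubmonoidClass.coe_finsetSum, coe_fn, reg_sum I _ hs]
  rfl

theorem continuous_fn_mul {r s : ℝ → ℝ} (hr : PiecewiseSmooth r) (hs : PiecewiseSmooth s)
    (hrc : Continuous r) (hsc : Continuous s) :
    mul (A.fn r hr) (A.fn s hs) = A.fn _ (hr.mul hs) :=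
  Subtype.ext (A.mul_continuous r s hrc hsc _ _ rfl rfl)

/-- The ramp is continuous, which settles continuous left factors. For a step, the smooth factor x -
b is pulled out, leaving a product of two steps. -/
theorem fn_mul_ramp {f : ℝ → ℝ} (hf : PiecewiseSmooth f) (b : ℝ) :
    mul (A.fn f hf) (A.fn (ramp b) (piecewiseSmooth_ramp b)) =
      A.fn _ (hf.mul (piecewiseSmooth_ramp b)) := by
  refine A.fn_mul_of (piecewiseSmooth_ramp b) _
    (fun r hr hc => A.continuous_fn_mul hr _ hc (continuous_ramp b)) (fun a => ?_) hf
  rw [← A.sub_mul_step, A.mul_smooth_mul, A.assoc, A.step_mul_step, A.smooth_mul_fn]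
  refine A.fn_congr _ _ fun x => ?_
  rw [ramp]
  ring

/-- The product of a continuous piecewise smooth function and of a step function. -/
theorem fn_mul_step_of_continuous {r : ℝ → ℝ} (hr : PiecewiseSmooth r) (hc : Continuous r)
    (b : ℝ) : mul (A.fn r hr) (A.step b) =
      A.fn _ (hr.mul (piecewiseSmooth_heaviside b)) := by
  classical
  obtain ⟨I, hI⟩ := piecewiseSmooth_iff.1 hr
  -- The ramp has derivative H, so in (r R)' = r' R + r H every term but r H is already known.
  have h1 := A.leibniz (A.fn r hr) (A.fn (ramp b) (piecewiseSmooth_ramp b))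
  have hJ : SmoothOff (insert b I) (fun x => r x * ramp b x) :=
    (hI.mono (Finset.subset_insert b I)).mul
      ((SmoothOff.of_contDiff (contDiff_sub_const b) _).mul
        ((smoothOff_heaviside b).mono (by simp)))
  rw [A.d_fn_of_continuous hc hI, A.d_ramp, A.fn_mul_ramp, A.fn_mul_ramp,
    A.d_fn_of_continuous (r := fun x => r x * ramp b x) (hc.mul (continuous_ramp b)) hJ] at h1
  rw [← sub_eq_iff_eq_add'.2 h1, sub_eq_iff_eq_add, ← A.fn_add]
  refine A.fn_congr_off (I := insert b I) _ _ fun x hx => ?_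
  rw [Finset.mem_insert, not_or] at hx
  have hd := ((hI.1 x hx.2).differentiableAt (by simp)).hasDerivAt
  have hH : HasDerivAt (heaviside b) 0 x := by
    rw [← deriv_heaviside hx.1]
    exact (((smoothOff_heaviside b).1 x (by simpa using hx.1)).differentiableAt
      (by simp)).hasDerivAt
  have hramp : HasDerivAt (ramp b) (heaviside b x) x :=
    (((hasDerivAt_id x).sub_const b).mul hH).congr_deriv (by simp)
  have h2 : deriv (fun x => r x * ramp b x) x = deriv r x * ramp b x + r x * heaviside b x :=
    (hd.mul hramp).deriv
  rw [h2, add_comm]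

theorem fn_mul_step {f : ℝ → ℝ} (hf : PiecewiseSmooth f) (b : ℝ) :
    mul (A.fn f hf) (A.step b) = A.fn _ (hf.mul (piecewiseSmooth_heaviside b)) :=
  A.fn_mul_of (piecewiseSmooth_heaviside b) _
    (fun _ hr hc => A.fn_mul_step_of_continuous hr hc b) (fun a => A.step_mul_step a b) hf

/-- Each factor splits into a continuous function and steps; the second factor is split in the
opposite algebra. -/
theorem fn_mul_fn {f g : ℝ → ℝ} (hf : PiecewiseSmooth f) (hg : PiecewiseSmooth g) :
    mul (A.fn f hf) (A.fn g hg) = A.fn _ (hf.mul hg) := by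
  refine (A.flip.fn_mul_of hf (A.fn f hf) (fun s hs hc => ?_) (fun b => ?_) hg).trans
    (A.fn_congr (hg.mul hf) _ fun x => mul_comm _ _)
  · refine (A.fn_mul_of hs (A.fn s hs) (fun r hr hrc => A.continuous_fn_mul hr hs hrc hc)
      (fun a => ?_) hf).trans (A.fn_congr (hf.mul hs) (hs.mul hf) fun x => mul_comm _ _)
    exact (A.flip.fn_mul_step_of_continuous hs hc a).trans
      (A.fn_congr (hs.mul (piecewiseSmooth_heaviside a))
        ((piecewiseSmooth_heaviside a).mul hs) fun x => mul_comm _ _)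
  · exact (A.fn_mul_step hf b).trans
      (A.fn_congr (hf.mul (piecewiseSmooth_heaviside b))
        ((piecewiseSmooth_heaviside b).mul hf) fun x => mul_comm _ _)

/-! ### Products with Dirac measures -/

/-- If H δ = 0 then δ H = δ, so δ δ^(j) = δ (H δ^(j)). This vanishes once H δ^(j) does, and Leibniz
carries H δ^(j) = 0 from j to j + 1. A further use of Leibniz raises i. -/
theorem delta_mul_delta_self {a : ℝ} (h : mul (A.step a) (A.delta a 0) = 0) (i j : ℕ) :
    mul (A.delta a i) (A.delta a j) = 0 := by
  have h1 : mul (A.delta a 0) (A.step a) = A.delta a 0 := by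
    simpa [h] using A.delta_mul_step_add a
  have h2 : ∀ j, mul (A.step a) (A.delta a j) = 0 → mul (A.delta a 0) (A.delta a j) = 0 :=
    fun j hj => by rw [← h1, A.assoc, hj, map_zero]
  have h3 : ∀ j, mul (A.step a) (A.delta a j) = 0 := by
    intro j
    induction j with
    | zero => exact h
    | succ j ih =>
      have := congrArg d ih
      rwa [A.leibniz, A.d_step, h2 j ih, zero_add, A.d_delta, map_zero] at this
  induction i generalizing j with
  | zero => exact h2 j (h3 j)
  | succ i ih =>
    have := congrArg d (ih j)
    rwa [A.leibniz, A.d_delta, A.d_delta, ih, add_zero, map_zero] at this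

theorem delta_mul_delta (a b : ℝ) (i j : ℕ) : mul (A.delta a i) (A.delta b j) = 0 := by
  rcases eq_or_ne a b with rfl | hab
  · rcases A.step_mul_delta_eq_or a with h | h
    · exact A.delta_mul_delta_self h i j
    -- If H δ = δ then δ H = 0, which is the other case read in the opposite algebra.
    · refine A.flip.delta_mul_delta_self (a := a) ?_ j i
      have := A.delta_mul_step_add a
      rw [h] at this
      exact add_eq_right.1 this
  · exact A.delta_mul_delta_of_ne hab i j

/-- The value `f(a-) + κ (f(a+) - f(a-))`. -/
def midVal (κ : ℝ) (f : ℝ → ℝ) (a : ℝ) : ℝ := leftVal f a + κ * jump f a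

/-- Split r H = (r - r(a)) H + r(a) H and differentiate. The first summand is continuous, so the
only Dirac term on the right is r(a) δ. -/
theorem fn_mul_delta_of_continuous {r : ℝ → ℝ} (hr : PiecewiseSmooth r) (hc : Continuous r)
    (a : ℝ) : mul (A.fn r hr) (A.delta a 0) = r a • A.delta a 0 := by
  classical
  obtain ⟨I, hI⟩ := piecewiseSmooth_iff.1 hr
  have hs : SmoothOff (insert a I) (fun x => (r x + -r a) * heaviside a x) :=
    ((hI.mono (Finset.subset_insert a I)).add (.of_contDiff contDiff_const _)).mul
      ((smoothOff_heaviside a).mono (by simp))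
  have hsc : Continuous fun x => (r x + -r a) * heaviside a x := by
    have : (fun x => (r x + -r a) * heaviside a x) = fun x => r (max x a) + -r a := by
      ext x
      rcases lt_or_ge a x with h | h
      · rw [heaviside_of_lt h, mul_one, max_eq_left h.le]
      · rw [heaviside_of_le h, mul_zero, max_eq_right h, add_neg_cancel]
    rw [this]
    fun_prop
  have h1 : mul (A.fn r hr) (A.step a) = A.fn _ hs.piecewiseSmooth + r a • A.step a := by
    rw [A.fn_mul_step, step, ← A.fn_const_mul, ← A.fn_add]
    refine A.fn_congr _ _ fun x => ?_
    ring
  have h2 := congrArg d h1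
  rw [A.leibniz, A.d_step, map_add, map_smul, A.d_step, A.d_fn_of_continuous hc hI,
    A.d_fn_of_continuous hsc hs, A.fn_mul_step] at h2
  refine add_left_cancel (h2.trans ?_)
  congr 1
  refine A.fn_congr_off (I := insert a I) _ _ fun x hx => ?_
  rw [Finset.mem_insert, not_or] at hx
  have hd := ((hI.1 x hx.2).differentiableAt (by simp)).hasDerivAt
  have hH : HasDerivAt (heaviside a) 0 x := by
    rw [← deriv_heaviside hx.1]
    exact (((smoothOff_heaviside a).1 x (by simpa using hx.1)).differentiableAt
      (by simp)).hasDerivAt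
  have h3 : deriv (fun x => (r x + -r a) * heaviside a x) x =
      deriv r x * heaviside a x + (r x + -r a) * 0 := ((hd.add_const _).mul hH).deriv
  rw [h3]
  ring

/-- Steps located before a act on δ as 1, those after a as 0, and the one at a as κ. Hence f acts by
its left value plus κ times its jump. -/
theorem fn_mul_delta_zero {a κ : ℝ} (h : mul (A.step a) (A.delta a 0) = κ • A.delta a 0)
    {f : ℝ → ℝ} (hf : PiecewiseSmooth f) :
    mul (A.fn f hf) (A.delta a 0) = midVal κ f a • A.delta a 0 := by
  classical
  obtain ⟨I₀, hI₀⟩ := piecewiseSmooth_iff.1 hf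
  -- The point a is forced into the exceptional set so that its jump, possibly zero, occurs in the
  -- sum.
  have hI := hI₀.mono (Finset.subset_insert a I₀)
  set I := insert a I₀ with hIdef
  have haI : a ∈ I := Finset.mem_insert_self a I₀
  obtain ⟨r, hr, hc, hfr, hfn⟩ := A.exists_fn_eq hI
  have hstep : ∀ b, mul (A.step b) (A.delta a 0) =
      ((if b < a then 1 else 0) + κ * (if b = a then 1 else 0)) • A.delta a 0 := by
    intro b
    rcases lt_trichotomy b a with hb | rfl | hb
    · simp [A.step_mul_delta_of_lt hb, hb, hb.ne]
    · simp [h]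
    · simp [A.step_mul_delta_of_gt hb, hb.not_gt, hb.ne']
  have hval : leftVal f a = r a + ∑ b ∈ I, jump f b * (if b < a then 1 else 0) := by
    refine leftVal_eq ?_
    have h1 : Tendsto r (𝓝[<] a) (𝓝 (r a)) := (hc.tendsto a).mono_left nhdsWithin_le_nhds
    refine (h1.add (tendsto_finsetSum I fun b _ =>
      (tendsto_heaviside_left b a).const_mul (jump f b))).congr' ?_
    filter_upwards [eventually_lt_notMem I a] with x hx
    exact (hfr x hx).symm
  rw [hfn, map_add, LinearMap.add_apply, A.fn_mul_delta_of_continuous _ hc, map_sum,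
    LinearMap.sum_apply]
  simp_rw [map_smul, LinearMap.smul_apply, hstep, smul_smul]
  rw [← Finset.sum_smul, ← add_smul, midVal, hval]
  congr 1
  simp_rw [mul_add, Finset.sum_add_distrib]
  have : ∑ b ∈ I, jump f b * (κ * if b = a then 1 else 0) = κ * jump f a := by
    rw [Finset.sum_eq_single_of_mem a haI fun b _ hb => by simp [hb]]
    simp [mul_comm]
  rw [this, add_assoc]

end DerivAlgebra

/-! ### Multiplying derivatives of the Dirac measure by a jet -/

/-- The product of a function with derivatives `c 0, c 1, …` at `z` and of the `j`-th derivative of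
the Dirac measure at `z`. -/
def jetMulDirac (z : ℝ) : (ℕ → ℝ) → ℕ → Distr
  | c, 0 => c 0 • dirac z
  | c, j + 1 => D (jetMulDirac z c j) - jetMulDirac z (fun n => c (n + 1)) j

/-- Leibniz yields the recursion defining `jetMulDirac`: the Dirac terms that the jumps of f add to
its derivative are killed by `delta_mul_delta`. -/
theorem DerivAlgebra.fn_mul_delta {G : Submodule ℝ Distr} {mul : G →ₗ[ℝ] G →ₗ[ℝ] G}
    {d : G →ₗ[ℝ] G} (A : DerivAlgebra G mul d) {a κ : ℝ}
    (h : mul (A.step a) (A.delta a 0) = κ • A.delta a 0) {f : ℝ → ℝ} (hf : PiecewiseSmooth f)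
    (j : ℕ) : (mul (A.fn f hf) (A.delta a j) : Distr) =
      jetMulDirac a (fun n => midVal κ (iteratedDeriv n f) a) j := by
  induction j generalizing f with
  | zero =>
    rw [A.fn_mul_delta_zero h, Submodule.coe_smul, A.coe_delta, jetMulDirac, iteratedDeriv_zero]
    rfl
  | succ j ih =>
    obtain ⟨I, hI⟩ := piecewiseSmooth_iff.1 hf
    have h1 := A.leibniz (A.fn f hf) (A.delta a j)
    rw [A.d_fn hI, map_add, LinearMap.add_apply, map_sum, LinearMap.sum_apply,
      Finset.sum_eq_zero fun b _ => by
        rw [map_smul, LinearMap.smul_apply, A.delta_mul_delta, smul_zero], add_zero,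
      A.d_delta] at h1
    rw [← sub_eq_iff_eq_add'.2 h1, Submodule.coe_sub, A.coe_d, ih, ih, jetMulDirac]
    simp_rw [iteratedDeriv_succ']

/-! ### Products of functions and Dirac measures as star products -/

/-- The passage ε ↓ 0 in the star product reduces to convergence of the base point and of each jet
coefficient. -/
theorem jetMulDirac_tendsto {ι : Type} {l : Filter ι} {z : ι → ℝ} {z₀ : ℝ} {c : ι → ℕ → ℝ}
    {c₀ : ℕ → ℝ} (hz : Tendsto z l (𝓝 z₀)) (hc : ∀ n, Tendsto (fun i => c i n) l (𝓝 (c₀ n)))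
    (j : ℕ) : TendstoDistr (fun i => jetMulDirac (z i) (c i) j) l (jetMulDirac z₀ c₀ j) := by
  induction j generalizing c c₀ with
  | zero => exact fun t => (hc 0).mul ((t.continuous.tendsto z₀).comp hz)
  | succ j ih =>
    intro t
    simp only [jetMulDirac, Distr.sub_apply, D_apply_derivTest]
    exact ((ih hc (derivTest t)).neg).sub (ih (fun n => hc (n + 1)) t)

theorem TestFn.eq_zero_of_notMem {Ω : Set ℝ} {t : TestFn ⊤} (ht : tsupport t ⊆ Ω) {x : ℝ}
    (hx : x ∉ Ω) : t x = 0 := image_eq_zero_of_notMem_tsupport fun h => hx (ht h)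

theorem tsupport_derivTest_subset (t : TestFn ⊤) : tsupport (derivTest t) ⊆ tsupport t := by
  have : (derivTest t : ℝ → ℝ) = deriv t := funext (derivTest_apply t)
  rw [this]
  exact closure_minimal support_deriv_subset (isClosed_tsupport _)

theorem derivTest_mulOn {Ω : Opens ℝ} {φ : ℝ → ℝ} (hφ : ContDiffOn ℝ ∞ φ Ω)
    (hφ' : ContDiffOn ℝ ∞ (deriv φ) Ω) (t : TestFn ⊤) (ht : tsupport t ⊆ Ω) :
    derivTest (mulOn hφ t ht) = mulOn hφ' t ht +
      mulOn hφ (derivTest t) ((tsupport_derivTest_subset t).trans ht) := by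
  ext x
  change derivTest (mulOn hφ t ht) x = deriv φ x * t x + φ x * derivTest t x
  by_cases hx : x ∈ Ω
  · rw [derivTest_apply, derivTest_apply]
    exact deriv_mul ((hφ.contDiffAt (Ω.isOpen.mem_nhds hx)).differentiableAt (by simp))
      (TestFn.differentiable t x)
  · rw [TestFn.eq_zero_of_notMem ht hx,
      TestFn.eq_zero_of_notMem ((tsupport_derivTest_subset t).trans ht) hx,
      TestFn.eq_zero_of_notMem
        ((tsupport_derivTest_subset _).trans (tsupport_mulOn_subset hφ t ht)) hx]
    ring

/-- The dual product by a smooth function also obeys Leibniz, so the recursion that describes ⊛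
describes it as well. This links the two products. -/
theorem jetMulDirac_apply {Ω : Opens ℝ} {z : ℝ} {φ : ℝ → ℝ} (hφ : ContDiffOn ℝ ∞ φ Ω)
    (t : TestFn ⊤) (ht : tsupport t ⊆ Ω) (j : ℕ) :
    jetMulDirac z (fun n => iteratedDeriv n φ z) j t = (D^[j]) (dirac z) (mulOn hφ t ht) := by
  induction j generalizing φ t with
  | zero => rfl
  | succ j ih =>
    have hφ' : ContDiffOn ℝ ∞ (deriv φ) Ω :=
      ((contDiffOn_infty_iff_deriv_of_isOpen Ω.isOpen).1 hφ).2
    rw [Function.iterate_succ_apply', D_apply_derivTest, derivTest_mulOn hφ hφ', map_add,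
      ← ih hφ', ← ih hφ, jetMulDirac, Distr.sub_apply, D_apply_derivTest]
    simp_rw [iteratedDeriv_succ']
    ring

theorem jetMulDirac_eq_zero {z : ℝ} (c : ℕ → ℝ) (j : ℕ) {t : TestFn ⊤} (ht : z ∉ tsupport t) :
    jetMulDirac z c j t = 0 := by
  induction j generalizing c t with
  | zero =>
    change c 0 * t z = 0
    rw [image_eq_zero_of_notMem_tsupport ht, mul_zero]
  | succ j ih =>
    rw [jetMulDirac, Distr.sub_apply, D_apply_derivTest, ih c fun h =>
      ht (tsupport_derivTest_subset t h), ih _ ht, neg_zero, sub_zero]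

/-- The linear combination `∑ⱼ aⱼ δ_z^(j)`. -/
def diracComb (z : ℝ) (a : ℕ →₀ ℝ) : Distr := ∑ j ∈ a.support, a j • (D^[j]) (dirac z)

/-- The product of a function with derivatives `c 0, c 1, …` at `z` and of `∑ⱼ aⱼ δ_z^(j)`. -/
def jetMulComb (z : ℝ) (c : ℕ → ℝ) (a : ℕ →₀ ℝ) : Distr :=
  ∑ j ∈ a.support, a j • jetMulDirac z c j

theorem mem_span_dirac_iff {z : ℝ} {F : Distr} :
    F ∈ Submodule.span ℝ (range fun j : ℕ => (D^[j]) (Distribution.delta z : Distr)) ↔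
      ∃ a : ℕ →₀ ℝ, F = diracComb z a := by
  rw [Finsupp.mem_span_range_iff_exists_finsupp]
  exact exists_congr fun a => eq_comm

theorem translate_diracComb (ε z : ℝ) (a : ℕ →₀ ℝ) :
    translate ε (diracComb z a) = diracComb (z - ε) a := by
  refine Distr.ext fun t => ?_
  rw [translate_apply, diracComb, diracComb, Distr.sum_apply, Distr.sum_apply]
  refine Finset.sum_congr rfl fun j _ => ?_
  rw [Distr.smul_apply, Distr.smul_apply, ← translate_D_iterate_dirac, translate_apply]

theorem jetMulComb_tendsto {ι : Type} {l : Filter ι} {z : ι → ℝ} {z₀ : ℝ} {c : ι → ℕ → ℝ}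
    {c₀ : ℕ → ℝ} (hz : Tendsto z l (𝓝 z₀)) (hc : ∀ n, Tendsto (fun i => c i n) l (𝓝 (c₀ n)))
    (a : ℕ →₀ ℝ) : TendstoDistr (fun i => jetMulComb (z i) (c i) a) l (jetMulComb z₀ c₀ a) := by
  intro t
  simp only [jetMulComb, Distr.sum_apply, Distr.smul_apply]
  exact tendsto_finsetSum _ fun j _ => (jetMulDirac_tendsto hz hc j t).const_mul _

theorem jetMulComb_apply {Ω : Opens ℝ} {z : ℝ} {φ : ℝ → ℝ} (hφ : ContDiffOn ℝ ∞ φ Ω)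
    (t : TestFn ⊤) (ht : tsupport t ⊆ Ω) (a : ℕ →₀ ℝ) :
    jetMulComb z (fun n => iteratedDeriv n φ z) a t = diracComb z a (mulOn hφ t ht) := by
  simp only [jetMulComb, diracComb, Distr.sum_apply, Distr.smul_apply, jetMulDirac_apply hφ t ht]

theorem jetMulComb_eq_zero {z : ℝ} (c : ℕ → ℝ) (a : ℕ →₀ ℝ) {t : TestFn ⊤}
    (ht : z ∉ tsupport t) : jetMulComb z c a t = 0 := by
  simp [jetMulComb, jetMulDirac_eq_zero c _ ht]

theorem diracComb_eq_zero {z : ℝ} (a : ℕ →₀ ℝ) {t : TestFn ⊤}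
    (ht : z ∉ tsupport t) : diracComb z a t = 0 := by
  rw [diracComb, Distr.sum_apply]
  refine Finset.sum_eq_zero fun j _ => ?_
  rw [Distr.smul_apply, D_iterate_dirac_eq_zero z j (notMem_tsupport_iff_eventuallyEq.1 ht),
    mul_zero]

/-- The complement of a finite set. -/
def complOpens (I : Finset ℝ) : Opens ℝ := ⟨(I : Set ℝ)ᶜ, isOpen_compl_finset I⟩

theorem mem_complOpens {I : Finset ℝ} {x : ℝ} : x ∈ complOpens I ↔ x ∉ I := Iff.rfl

theorem SmoothOff.isSmoothOn {I : Finset ℝ} {f : ℝ → ℝ} (hf : SmoothOff I f) :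
    IsSmoothOn (reg f) (complOpens I) f :=
  isSmoothOn_iff.2 ⟨fun x hx => (hf.1 x hx).contDiffWithinAt, fun t _ =>
    reg_apply hf.piecewiseSmooth.locallyIntegrable t⟩

theorem isSmoothOn_diracComb (z : ℝ) (a : ℕ →₀ ℝ) :
    IsSmoothOn (diracComb z a) (complOpens {z}) fun _ => 0 :=
  isSmoothOn_iff.2 ⟨contDiffOn_const, fun t ht => by
    rw [diracComb_eq_zero a fun h => ht h (Finset.mem_coe.2 (Finset.mem_singleton_self z))]
    simp⟩

theorem singSupport_subset {I : Finset ℝ} {F : Distr} {φ : ℝ → ℝ}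
    (h : IsSmoothOn F (complOpens I) φ) : singSupport F ⊆ I := fun x hx => by
  by_contra hI
  exact hx ⟨_, φ, hI, h⟩

/-- Two open sets suffice: off I the function is smooth, off z the Dirac part is zero, and they
cover the line because z ∉ I. -/
theorem isHormanderProd_diracComb {I : Finset ℝ} {f : ℝ → ℝ} (hf : SmoothOff I f) {z : ℝ}
    (hz : z ∉ I) (a : ℕ →₀ ℝ) : IsHormanderProd (reg f) (diracComb z a)
      (jetMulComb z (fun n => iteratedDeriv n f z) a) := by
  have h1 := singSupport_subset hf.isSmoothOn
  have h2 := singSupport_subset (isSmoothOn_diracComb z a)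
  refine ⟨I.finite_toSet.subset h1, (Finset.finite_toSet _).subset h2,
    Disjoint.mono h1 h2 (by simpa using hz), 2, ![complOpens I, complOpens {z}], ?_, ?_⟩
  · refine eq_univ_of_forall fun x => mem_iUnion.2 ?_
    by_cases hx : x = z
    · exact ⟨0, hx ▸ hz⟩
    · exact ⟨1, mem_complOpens.2 (by simpa using hx)⟩
  · intro i
    fin_cases i
    · refine Or.inl (isDualProdOn_iff.2 ⟨f, hf.isSmoothOn, fun t u ht hu => ?_⟩)
      rw [jetMulComb_apply hf.isSmoothOn.1 t ht]
      congr 1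
      ext x
      exact (hu x).symm
    · refine Or.inr (isDualProdOn_iff.2 ⟨_, isSmoothOn_diracComb z a, fun t u ht hu => ?_⟩)
      have hu0 : u = 0 := by
        ext x
        rw [hu, zero_mul]
        rfl
      rw [hu0, map_zero]
      exact jetMulComb_eq_zero _ a fun h =>
        ht h (Finset.mem_coe.2 (Finset.mem_singleton_self z))

/-! ### Translates of functions and the one-sided limits -/

theorem HasJets.comp_add {f : ℝ → ℝ} {l l' : Filter ℝ} {ε : ℝ} (hf : HasJets f l')
    (h : Tendsto (fun x => x + ε) l l') : HasJets (fun x => f (x + ε)) l := by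
  refine ⟨(h.eventually hf.1).mono fun y hy => ContDiffAt.comp y hy
    (contDiffAt_id.add contDiffAt_const), fun n => ?_⟩
  obtain ⟨c, hc⟩ := hf.2 n
  refine ⟨c, ?_⟩
  rw [iteratedDeriv_comp_add_const]
  exact hc.comp h

theorem tendsto_add_left (x ε : ℝ) : Tendsto (fun y => y + ε) (𝓝[<] x) (𝓝[<] (x + ε)) :=
  tendsto_nhdsWithin_of_tendsto_nhds_of_eventually_within _
    ((continuous_add_const ε).continuousAt.tendsto.mono_left nhdsWithin_le_nhds)
    (by filter_upwards [self_mem_nhdsWithin] with y hy using add_lt_add_left hy ε)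

theorem tendsto_add_right (x ε : ℝ) : Tendsto (fun y => y + ε) (𝓝[>] x) (𝓝[>] (x + ε)) :=
  tendsto_nhdsWithin_of_tendsto_nhds_of_eventually_within _
    ((continuous_add_const ε).continuousAt.tendsto.mono_left nhdsWithin_le_nhds)
    (by filter_upwards [self_mem_nhdsWithin] with y hy using add_lt_add_left hy ε)

theorem SmoothOff.comp_add {I : Finset ℝ} {f : ℝ → ℝ} (hf : SmoothOff I f) (ε : ℝ) :
    SmoothOff (I.image fun x => x - ε) fun x => f (x + ε) := by
  refine ⟨fun x hx => ContDiffAt.comp x (hf.1 (x + ε) fun h => hx ?_)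
    (contDiffAt_id.add contDiffAt_const), fun x => ⟨(hf.2 (x + ε)).1.comp_add
      (tendsto_add_left x ε), (hf.2 (x + ε)).2.comp_add (tendsto_add_right x ε)⟩⟩
  exact Finset.mem_image.2 ⟨x + ε, h, by simp⟩

theorem SmoothOff.translate_reg {I : Finset ℝ} {f : ℝ → ℝ} (hf : SmoothOff I f) (ε : ℝ) :
    translate ε (reg f) = reg fun x => f (x + ε) := by
  refine Distr.ext fun t => ?_
  rw [translate_apply, reg_apply hf.piecewiseSmooth.locallyIntegrable,
    reg_apply (hf.comp_add ε).piecewiseSmooth.locallyIntegrable,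
    ← integral_add_right_eq_self _ ε]
  congr 1
  ext x
  change t (x + ε - ε) * f (x + ε) = t x * f (x + ε)
  rw [add_sub_cancel_right]

theorem tendsto_const_sub_nhdsGT (y : ℝ) :
    Tendsto (fun ε => y - ε) (𝓝[>] (0 : ℝ)) (𝓝[<] y) := by
  refine tendsto_nhdsWithin_of_tendsto_nhds_of_eventually_within _ ?_ ?_
  · have : Tendsto (fun ε => y - ε) (𝓝 (0 : ℝ)) (𝓝 (y - 0)) :=
      (continuous_const.sub continuous_id).tendsto 0
    rw [sub_zero] at this
    exact this.mono_left nhdsWithin_le_nhds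
  · filter_upwards [self_mem_nhdsWithin] with ε hε using sub_lt_self y hε

theorem tendsto_const_add_nhdsGT (y : ℝ) :
    Tendsto (fun ε => y + ε) (𝓝[>] (0 : ℝ)) (𝓝[>] y) := by
  refine tendsto_nhdsWithin_of_tendsto_nhds_of_eventually_within _ ?_ ?_
  · have : Tendsto (fun ε => y + ε) (𝓝 (0 : ℝ)) (𝓝 (y + 0)) :=
      (continuous_const.add continuous_id).tendsto 0
    rw [add_zero] at this
    exact this.mono_left nhdsWithin_le_nhds
  · filter_upwards [self_mem_nhdsWithin] with ε hε using lt_add_of_pos_right y hε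

/-- The shift moves the Dirac part to y - ε, which avoids I for small ε, so the jet of f is taken
from the left. -/
theorem isStarProd_reg_diracComb {f : ℝ → ℝ} (hf : PiecewiseSmooth f) (y : ℝ) (a : ℕ →₀ ℝ) :
    IsStarProd (reg f) (diracComb y a)
      (jetMulComb y (fun n => leftVal (iteratedDeriv n f) y) a) := by
  obtain ⟨I, hI⟩ := piecewiseSmooth_iff.1 hf
  have hlim := tendsto_const_sub_nhdsGT y
  refine ⟨fun ε => jetMulComb (y - ε) (fun n => iteratedDeriv n f (y - ε)) a, ?_,
    jetMulComb_tendsto (hlim.mono_right nhdsWithin_le_nhds)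
      (fun n => ((hf.iteratedDeriv n).tendsto_left y).comp hlim) a⟩
  filter_upwards [hlim.eventually (eventually_lt_notMem I y)] with ε hε
  rw [translate_diracComb]
  exact isHormanderProd_diracComb hI hε a

/-- Now f is shifted while the Dirac part stays at y, so the jet is that of f at y + ε and tends to
the right jet. -/
theorem isStarProd_diracComb_reg {f : ℝ → ℝ} (hf : PiecewiseSmooth f) (y : ℝ) (a : ℕ →₀ ℝ) :
    IsStarProd (diracComb y a) (reg f)
      (jetMulComb y (fun n => rightVal (iteratedDeriv n f) y) a) := by
  obtain ⟨I, hI⟩ := piecewiseSmooth_iff.1 hf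
  have hlim := tendsto_const_add_nhdsGT y
  refine ⟨fun ε => jetMulComb y (fun n => iteratedDeriv n f (y + ε)) a, ?_,
    jetMulComb_tendsto tendsto_const_nhds
      (fun n => ((hf.iteratedDeriv n).tendsto_right y).comp hlim) a⟩
  filter_upwards [hlim.eventually (eventually_gt_notMem I y)] with ε hε
  rw [hI.translate_reg]
  have h := isHormanderProd_diracComb (hI.comp_add ε) (z := y) (fun h => by
    obtain ⟨x, hx, hxy⟩ := Finset.mem_image.1 h
    exact hε (by rwa [← hxy, sub_add_cancel])) a
  simp only [iteratedDeriv_comp_add_const] at h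
  exact h.symm

/-! ### The space of derivatives of piecewise smooth functions -/

theorem PiecewiseSmooth.exists_D_iterate_eq {f : ℝ → ℝ} (hf : PiecewiseSmooth f) (k : ℕ) :
    ∃ g, PiecewiseSmooth g ∧ (D^[k]) (reg g) = reg f := by
  induction k with
  | zero => exact ⟨f, hf, rfl⟩
  | succ k ih =>
    obtain ⟨g, hg, h⟩ := ih
    obtain ⟨g', hg', h'⟩ := hg.exists_D_eq
    exact ⟨g', hg', by rw [Function.iterate_succ_apply, h', h]⟩

theorem reg_mem_spaceA {f : ℝ → ℝ} (hf : PiecewiseSmooth f) : reg f ∈ spaceA := ⟨0, f, hf, rfl⟩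

theorem D_mem_spaceA {F : Distr} (hF : F ∈ spaceA) : D F ∈ spaceA := by
  obtain ⟨i, f, hf, rfl⟩ := hF
  exact ⟨i + 1, f, hf, (Function.iterate_succ_apply' D i _).symm⟩

/-- The space `𝓐` as a linear subspace. -/
def submoduleA : Submodule ℝ Distr where
  carrier := spaceA
  zero_mem' := by
    have h := reg_const_mul 0 (contDiff_const (c := (0 : ℝ))).piecewiseSmooth.locallyIntegrable
    rw [zero_smul] at h
    rw [← h]
    exact reg_mem_spaceA (contDiff_const.piecewiseSmooth.const_mul 0)
  add_mem' := by
    rintro _ _ ⟨i, f, hf, rfl⟩ ⟨j, g, hg, rfl⟩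
    obtain ⟨f', hf', h1⟩ := hf.exists_D_iterate_eq j
    obtain ⟨g', hg', h2⟩ := hg.exists_D_iterate_eq i
    -- Primitives bring both summands to the common order i + j.
    refine ⟨i + j, _, hf'.add hg', ?_⟩
    rw [reg_add hf'.locallyIntegrable hg'.locallyIntegrable, D_iterate_add,
      Function.iterate_add_apply, h1, add_comm i j, Function.iterate_add_apply, h2]
  smul_mem' := by
    rintro c _ ⟨i, f, hf, rfl⟩
    exact ⟨i, _, hf.const_mul c, by rw [reg_const_mul c hf.locallyIntegrable, D_iterate_smul]⟩

theorem mem_submoduleA {F : Distr} : F ∈ submoduleA ↔ F ∈ spaceA := Iff.rfl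

theorem jetMulDirac_mem (z : ℝ) (c : ℕ → ℝ) (j : ℕ) : jetMulDirac z c j ∈ submoduleA := by
  induction j generalizing c with
  | zero =>
    refine submoduleA.smul_mem _ ?_
    rw [← D_reg_heaviside]
    exact D_mem_spaceA (reg_mem_spaceA (piecewiseSmooth_heaviside z))
  | succ j ih => exact submoduleA.sub_mem (D_mem_spaceA (ih c)) (ih _)

theorem jetMulComb_mem (z : ℝ) (c : ℕ → ℝ) (a : ℕ →₀ ℝ) : jetMulComb z c a ∈ submoduleA :=
  submoduleA.sum_mem fun j _ => submoduleA.smul_mem _ (jetMulDirac_mem z c j)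

/-- The distributions supported at `x`: the combinations of the derivatives of `δ_x`. -/
abbrev diracSpan (x : ℝ) : Submodule ℝ Distr :=
  Submodule.span ℝ (range fun j : ℕ => (D^[j]) (Distribution.delta x : Distr))

theorem D_mem_diracSpan {x : ℝ} {F : Distr} (hF : F ∈ diracSpan x) : D F ∈ diracSpan x := by
  induction hF using Submodule.span_induction with
  | mem F h =>
    obtain ⟨j, rfl⟩ := h
    exact Submodule.subset_span ⟨j + 1, Function.iterate_succ_apply' D j _⟩
  | zero => simp
  | add F H _ _ h1 h2 => rw [map_add]; exact Submodule.add_mem _ h1 h2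
  | smul c F _ h => rw [map_smul]; exact Submodule.smul_mem _ _ h

theorem finsupp_sum_eq (Δ : ℝ →₀ Distr) : ∑ x ∈ Δ.support, Δ x = Δ.sum fun _ F => F := rfl

/-- The distribution `F` has a decomposition into a function and Dirac parts. -/
def HasDecomp (F : Distr) : Prop := ∃ f Δ, IsDecomp F f Δ

theorem HasDecomp.add {F H : Distr} (hF : HasDecomp F) (hH : HasDecomp H) : HasDecomp (F + H) := by
  classical
  obtain ⟨f, Δ, hf, hΔ, rfl⟩ := hF
  obtain ⟨h, Θ, hh, hΘ, rfl⟩ := hH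
  refine ⟨_, Δ + Θ, hf.add hh, fun x => Submodule.add_mem _ (hΔ x) (hΘ x), ?_⟩
  rw [reg_add hf.locallyIntegrable hh.locallyIntegrable, finsupp_sum_eq, finsupp_sum_eq,
    finsupp_sum_eq, Finsupp.sum_add_index' (fun _ => rfl) (fun _ _ _ => rfl)]
  abel

theorem hasDecomp_reg {f : ℝ → ℝ} (hf : PiecewiseSmooth f) : HasDecomp (reg f) :=
  ⟨f, 0, hf, fun _ => Submodule.zero_mem _, by simp⟩

theorem hasDecomp_of_mem_diracSpan {x : ℝ} {F : Distr} (hF : F ∈ diracSpan x) : HasDecomp F := by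
  classical
  -- The zero function is written as a multiple by 0 so that `reg_const_mul` shows its distribution
  -- to be 0.
  refine ⟨fun y => 0 * (fun _ => (0 : ℝ)) y, Finsupp.single x F,
    contDiff_const.piecewiseSmooth.const_mul 0, fun y => ?_, ?_⟩
  · rw [Finsupp.single_apply]
    split_ifs with h
    · exact h ▸ hF
    · exact Submodule.zero_mem _
  · rw [reg_const_mul 0 contDiff_const.piecewiseSmooth.locallyIntegrable, zero_smul, zero_add,
      finsupp_sum_eq, Finsupp.sum_single_index rfl]

theorem HasDecomp.sum {ι : Type*} (s : Finset ι) {F : ι → Distr} (h : ∀ i ∈ s, HasDecomp (F i)) :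
    HasDecomp (∑ i ∈ s, F i) := by
  classical
  induction s using Finset.induction_on with
  | empty => exact hasDecomp_of_mem_diracSpan (x := 0) (Submodule.zero_mem _)
  | insert a s ha ih =>
    rw [Finset.sum_insert ha]
    exact (h a (Finset.mem_insert_self a s)).add
      (ih fun i hi => h i (Finset.mem_insert_of_mem hi))

theorem HasDecomp.D {F : Distr} (hF : HasDecomp F) : HasDecomp (D F) := by
  obtain ⟨f, Δ, hf, hΔ, rfl⟩ := hF
  obtain ⟨I, hI⟩ := piecewiseSmooth_iff.1 hf
  rw [map_add, hI.D_reg, map_sum]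
  refine ((hasDecomp_reg hf.deriv).add (HasDecomp.sum I fun a _ => ?_)).add
    (HasDecomp.sum _ fun x _ => hasDecomp_of_mem_diracSpan (D_mem_diracSpan (hΔ x)))
  exact hasDecomp_of_mem_diracSpan (x := a)
    (Submodule.smul_mem _ _ (Submodule.subset_span ⟨0, rfl⟩))

theorem hasDecomp_of_mem_spaceA {F : Distr} (hF : F ∈ spaceA) : HasDecomp F := by
  obtain ⟨i, f, hf, rfl⟩ := hF
  induction i with
  | zero => exact hasDecomp_reg hf
  | succ i ih =>
    rw [Function.iterate_succ_apply']
    exact ih.D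

/-! ### Comparison of the products -/

theorem midVal_zero (f : ℝ → ℝ) (a : ℝ) : DerivAlgebra.midVal 0 f a = leftVal f a := by
  simp [DerivAlgebra.midVal]

theorem midVal_one (f : ℝ → ℝ) (a : ℝ) : DerivAlgebra.midVal 1 f a = rightVal f a := by
  simp [DerivAlgebra.midVal, jump]

namespace DerivAlgebra

variable {G : Submodule ℝ Distr} {mul : G →ₗ[ℝ] G →ₗ[ℝ] G} {d : G →ₗ[ℝ] G}
  (A : DerivAlgebra G mul d)

/-- The combination `∑ⱼ aⱼ δ_x^(j)` as an element of the algebra. -/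
def comb (x : ℝ) (a : ℕ →₀ ℝ) : G := ∑ j ∈ a.support, a j • A.delta x j

theorem coe_comb (x : ℝ) (a : ℕ →₀ ℝ) : (A.comb x a : Distr) = diracComb x a := by
  rw [comb, AddSubmonoidClass.coe_finsetSum, diracComb]
  simp_rw [Submodule.coe_smul, A.coe_delta]

theorem comb_mul_comb (x y : ℝ) (a b : ℕ →₀ ℝ) : mul (A.comb x a) (A.comb y b) = 0 := by
  rw [comb, comb, map_sum]
  refine Finset.sum_eq_zero fun j _ => ?_
  rw [map_smul, map_sum, LinearMap.sum_apply]
  rw [Finset.sum_eq_zero, smul_zero]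
  intro i _
  rw [map_smul, LinearMap.smul_apply, A.delta_mul_delta, smul_zero]

theorem fn_mul_comb {y κ : ℝ} (h : mul (A.step y) (A.delta y 0) = κ • A.delta y 0) {f : ℝ → ℝ}
    (hf : PiecewiseSmooth f) (a : ℕ →₀ ℝ) : (mul (A.fn f hf) (A.comb y a) : Distr) =
      jetMulComb y (fun n => midVal κ (iteratedDeriv n f) y) a := by
  rw [comb, map_sum, AddSubmonoidClass.coe_finsetSum, jetMulComb]
  refine Finset.sum_congr rfl fun j _ => ?_
  rw [map_smul, Submodule.coe_smul, A.fn_mul_delta h]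

theorem isStarProd_of_eq_zero {y : ℝ} (h : mul (A.step y) (A.delta y 0) = 0) {f : ℝ → ℝ}
    (hf : PiecewiseSmooth f) (a : ℕ →₀ ℝ) :
    IsStarProd (reg f) (diracComb y a) (mul (A.fn f hf) (A.comb y a) : G) := by
  rw [A.fn_mul_comb (κ := 0) (by rw [h, zero_smul])]
  simp_rw [midVal_zero]
  exact isStarProd_reg_diracComb hf y a

theorem isStarProd_of_eq_delta {y : ℝ} (h : mul (A.step y) (A.delta y 0) = A.delta y 0)
    {f : ℝ → ℝ} (hf : PiecewiseSmooth f) (a : ℕ →₀ ℝ) :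
    IsStarProd (diracComb y a) (reg f) (mul (A.fn f hf) (A.comb y a) : G) := by
  rw [A.fn_mul_comb (κ := 1) (by rw [h, one_smul])]
  simp_rw [midVal_one]
  exact isStarProd_diracComb_reg hf y a

theorem fn_mul_comb_mem {f : ℝ → ℝ} (hf : PiecewiseSmooth f) (y : ℝ) (a : ℕ →₀ ℝ) :
    (mul (A.fn f hf) (A.comb y a) : Distr) ∈ submoduleA := by
  rcases A.step_mul_delta_eq_or y with h | h
  · rw [A.fn_mul_comb (κ := 0) (by rw [h, zero_smul])]
    exact jetMulComb_mem _ _ _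
  · rw [A.fn_mul_comb (κ := 1) (by rw [h, one_smul])]
    exact jetMulComb_mem _ _ _

/-- The points where products with `δ` are taken in the given order. -/
def pointSet : Set ℝ := {y | mul (A.step y) (A.delta y 0) = 0}

theorem eq_delta_of_notMem {y : ℝ} (h : y ∉ A.pointSet) :
    mul (A.step y) (A.delta y 0) = A.delta y 0 := (A.step_mul_delta_eq_or y).resolve_left h

theorem delta_mul_step_of_mem {y : ℝ} (h : y ∈ A.pointSet) :
    mul (A.delta y 0) (A.step y) = A.delta y 0 := by
  have := A.delta_mul_step_add y
  rwa [(h : mul (A.step y) (A.delta y 0) = 0), add_zero] at this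

theorem delta_mul_step_of_notMem {y : ℝ} (h : y ∉ A.pointSet) :
    mul (A.delta y 0) (A.step y) = 0 := by
  have := A.delta_mul_step_add y
  rw [A.eq_delta_of_notMem h] at this
  exact add_eq_right.1 this

theorem eq_of_isDecomp {F : G} {f : ℝ → ℝ} {Δ : ℝ →₀ Distr} (hF : IsDecomp F f Δ)
    {a : ℝ → ℕ →₀ ℝ} (ha : ∀ x, Δ x = diracComb x (a x)) :
    F = A.fn f hF.1 + ∑ x ∈ Δ.support, A.comb x (a x) := by
  refine Subtype.ext (hF.2.2.trans ?_)
  rw [Submodule.coe_add, AddSubmonoidClass.coe_finsetSum, coe_fn]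
  simp_rw [A.coe_comb, ha]

/-- Expand bilinearly: the products of Dirac parts vanish, and function times function is pointwise.
-/
theorem coe_mul_of_isDecomp {F H : G} {f h : ℝ → ℝ} {Δ Θ : ℝ →₀ Distr} (hF : IsDecomp F f Δ)
    (hH : IsDecomp H h Θ) {a b : ℝ → ℕ →₀ ℝ} (ha : ∀ x, Δ x = diracComb x (a x))
    (hb : ∀ x, Θ x = diracComb x (b x)) :
    (mul F H : Distr) = reg (fun x => f x * h x) +
      ∑ y ∈ Θ.support, (mul (A.fn f hF.1) (A.comb y (b y)) : Distr) +
      ∑ x ∈ Δ.support, (mul (A.comb x (a x)) (A.fn h hH.1) : Distr) := by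
  have h0 : mul (∑ x ∈ Δ.support, A.comb x (a x)) (∑ y ∈ Θ.support, A.comb y (b y)) = 0 := by
    rw [map_sum]
    refine Finset.sum_eq_zero fun y _ => ?_
    rw [map_sum, LinearMap.sum_apply]
    exact Finset.sum_eq_zero fun x _ => A.comb_mul_comb x y _ _
  conv_lhs => rw [A.eq_of_isDecomp hF ha, A.eq_of_isDecomp hH hb]
  simp only [map_add, LinearMap.add_apply, h0, add_zero, A.fn_mul_fn]
  rw [map_sum mul, LinearMap.sum_apply, map_sum (mul (A.fn f hF.1))]
  simp only [Submodule.coe_add, AddSubmonoidClass.coe_finsetSum, coe_fn]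
  abel

/-- Every choice of decompositions computes `mul F H`, so well-definedness of the M-product follows
without proving that decompositions are unique. Terms with the Dirac part on the left are handled in
the opposite algebra, where κ becomes 1 - κ. -/
theorem isProdM_iff {F H : G} (hF : (F : Distr) ∈ spaceA) (hH : (H : Distr) ∈ spaceA)
    (P : Distr) : IsProdM A.pointSet F H P ↔ P = mul F H := by
  constructor
  · rintro ⟨f, h, Δ, Θ, hf, hh, p, q, hp, hq, rfl⟩
    choose a ha using fun x => mem_span_dirac_iff.1 (hf.2.1 x)
    choose b hb using fun x => mem_span_dirac_iff.1 (hh.2.1 x)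
    rw [A.coe_mul_of_isDecomp hf hh ha hb]
    congr 1
    · congr 1
      refine Finset.sum_congr rfl fun y hy => ?_
      obtain ⟨h1, h2⟩ := hp y hy
      rw [hb] at h1 h2
      by_cases hM : y ∈ A.pointSet
      · exact (h1 hM).unique (A.isStarProd_of_eq_zero hM hf.1 _)
      · exact (h2 hM).unique (A.isStarProd_of_eq_delta (A.eq_delta_of_notMem hM) hf.1 _)
    · refine Finset.sum_congr rfl fun x hx => ?_
      obtain ⟨h1, h2⟩ := hq x hx
      rw [ha] at h1 h2
      by_cases hM : x ∈ A.pointSet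
      · exact (h1 hM).unique
          (A.flip.isStarProd_of_eq_delta (A.delta_mul_step_of_mem hM) hh.1 _)
      · exact (h2 hM).unique
          (A.flip.isStarProd_of_eq_zero (A.delta_mul_step_of_notMem hM) hh.1 _)
  · rintro rfl
    obtain ⟨f, Δ, hf⟩ := hasDecomp_of_mem_spaceA hF
    obtain ⟨h, Θ, hh⟩ := hasDecomp_of_mem_spaceA hH
    choose a ha using fun x => mem_span_dirac_iff.1 (hf.2.1 x)
    choose b hb using fun x => mem_span_dirac_iff.1 (hh.2.1 x)
    refine ⟨f, h, Δ, Θ, hf, hh, _, _, fun y _ => ?_, fun x _ => ?_,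
      A.coe_mul_of_isDecomp hf hh ha hb⟩
    · rw [hb]
      exact ⟨fun hM => A.isStarProd_of_eq_zero hM hf.1 _, fun hM =>
        A.isStarProd_of_eq_delta (A.eq_delta_of_notMem hM) hf.1 _⟩
    · rw [ha]
      exact ⟨fun hM => A.flip.isStarProd_of_eq_delta (A.delta_mul_step_of_mem hM) hh.1 _,
        fun hM => A.flip.isStarProd_of_eq_zero (A.delta_mul_step_of_notMem hM) hh.1 _⟩

theorem mul_mem_spaceA (A : DerivAlgebra G mul d) {F H : G} (hF : (F : Distr) ∈ spaceA) (hH : (H : Distr) ∈ spaceA) :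
    (mul F H : Distr) ∈ spaceA := by
  obtain ⟨f, Δ, hf⟩ := hasDecomp_of_mem_spaceA hF
  obtain ⟨h, Θ, hh⟩ := hasDecomp_of_mem_spaceA hH
  choose a ha using fun x => mem_span_dirac_iff.1 (hf.2.1 x)
  choose b hb using fun x => mem_span_dirac_iff.1 (hh.2.1 x)
  rw [A.coe_mul_of_isDecomp hf hh ha hb, ← mem_submoduleA]
  exact submoduleA.add_mem (submoduleA.add_mem (reg_mem_spaceA (hf.1.mul hh.1))
    (submoduleA.sum_mem fun y _ => A.fn_mul_comb_mem hf.1 y _))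
    (submoduleA.sum_mem fun x _ => A.flip.fn_mul_comb_mem hh.1 x _)

theorem spaceA_subset (A : DerivAlgebra G mul d) : spaceA ⊆ (G : Set Distr) := by
  rintro _ ⟨i, f, hf, rfl⟩
  rw [← A.coe_fn f hf, ← A.coe_d_iterate]
  exact Subtype.property _

end DerivAlgebra

end

end DistrAlg

/-! ### The main theorem -/

theorem mainTheorem1 (G : Submodule ℝ DistrAlg.Distr) (mul : G →ₗ[ℝ] G →ₗ[ℝ] G)
    (hG : DistrAlg.IsDistrAlgebra G mul)
    (hloc : DistrAlg.LocallyDerivOfContinuous G)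
    (hcont : DistrAlg.PartiallyContinuousAt mul 0) :
    DistrAlg.spaceA ⊆ (G : Set DistrAlg.Distr) ∧
    (∃ S : Submodule ℝ DistrAlg.Distr, (S : Set DistrAlg.Distr) = DistrAlg.spaceA) ∧
    ∃ M : Set ℝ, ∀ F H : G,
      (F : DistrAlg.Distr) ∈ DistrAlg.spaceA → (H : DistrAlg.Distr) ∈ DistrAlg.spaceA →
        (mul F H : DistrAlg.Distr) ∈ DistrAlg.spaceA ∧
        ∀ P : DistrAlg.Distr, DistrAlg.IsProdM M F H P ↔ P = mul F H := by
  obtain ⟨d, hleib, hd⟩ := hG.exists_deriv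
  have A : DistrAlg.DerivAlgebra G mul d :=
    { assoc := hG.assoc
      reg_mem := hG.piecewiseSmooth_mem
      leibniz := hleib
      coe_d := hd
      mul_continuous := hG.mul_continuous
      smooth_left := fun _ hξ X F hX => (hG.smooth_mul hloc hcont hξ X F hX).1
      smooth_right := fun _ hξ X F hX => (hG.smooth_mul hloc hcont hξ X F hX).2 }
  exact ⟨A.spaceA_subset, ⟨DistrAlg.submoduleA, rfl⟩, A.pointSet, fun F H hF hH =>
    ⟨A.mul_mem_spaceA hF hH, A.isProdM_iff hF hH⟩⟩
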